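/- Let $\mathbb H$ denote the quaternions. A quaternionic $n\times n$ matrix $A=(a_{ij})$ is called hyperhermitian if $a_{ij}=\overline{a_{ji}}$ for all $i,j$; the hyperhermitian $n\times n$ matrices form a real vector space $\mathcal H_n$. Such a matrix is called positive definite (resp. non-negative definite) if the real number $A(x,x)=\sum_{i,j}\bar x_i a_{ij}x_j$ is positive for every non-zero $x\in\mathbb H^n$ (resp. non-negative for every $x\in\mathbb H^n$). Let ${}^{\mathbb R}A$ be the real symmetric $4n\times 4n$ matrix of the bilinear form $\operatorname{Re}\sum_{i,j}\bar x_i a_{ij}y_j$ on $\mathbb H^n=\mathbb R^{4n}$ in the standard real basis. The Moore determinant is the unique polynomial function $\det:\mathcal H_n\to\mathbb R$ such that $\det({}^{\mathbb R}A)=(\det A)^4$ for all $A\in\mathcal H_n$ and $\det(\mathrm{Id})=1$. The mixed discriminant $\det(A_1,\dots,A_n)$ of $A_1,\dots,A_n\in\mathcal H_n$ is the coefficient of the monomial $\lambda_1\cdots\lambda_n$ in the polynomial $\det(\lambda_1A_1+\dots+\lambda_nA_n)$ of the real variables $\lambda_1,\dots,\lambda_n$, divided by $n!$. **Theorem.**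 (i) If $A_1,\dots,A_n\in\mathcal H_n$ are positive definite (resp. non-negative definite), then $\det(A_1,\dots,A_n)>0$ (resp. $\det(A_1,\dots,A_n)\ge 0$). (ii) Let $n\ge 2$ and let $A_1,\dots,A_{n-2}\in\mathcal H_n$ be positive definite. Then $$B(X,Y)=\det(X,Y,A_1,\dots,A_{n-2})$$ is a symmetric bilinear form on the real vector space $\mathcal H_n$, it is non-degenerate, and its signature has exactly one plus and all the other signs minus, i.e. it is $(1,\dim_{\mathbb R}\mathcal H_n-1)$. -/

import Mathlib

open scoped Quaternion

namespace QuatMoore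

/-- The real vector space of hyperhermitian `n × n` matrices, i.e. quaternionic matrices with
`A i j = star (A j i)`. -/
def HyperHerm (n : ℕ) : Submodule ℝ (Matrix (Fin n) (Fin n) ℍ[ℝ]) where
  carrier := {A | A.IsHermitian}
  add_mem' := fun ha hb => Matrix.IsHermitian.add ha hb
  zero_mem' := Matrix.isHermitian_zero
  smul_mem' := fun c A hA => by
    ext i j : 1
    have h := Matrix.IsHermitian.apply hA i j
    simp only [Matrix.conjTranspose_apply, Matrix.smul_apply, Quaternion.star_smul]
    rw [h]

/-- The identity matrix as a hyperhermitian matrix. -/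
noncomputable def HyperHerm.id (n : ℕ) : HyperHerm n := ⟨1, Matrix.isHermitian_one⟩

/-- The hyperhermitian semilinear form `A(x, y) = ∑ x̄ᵢ aᵢⱼ yⱼ` on `ℍⁿ` defined by the matrix `A`. -/
noncomputable def hform {n : ℕ} (A : HyperHerm n) (x y : Fin n → ℍ[ℝ]) : ℍ[ℝ] :=
  ∑ i, ∑ j, star (x i) * A.1 i j * y j

lemma star_hform {n : ℕ} (A : HyperHerm n) (x y : Fin n → ℍ[ℝ]) :
    star (hform A x y) = hform A y x := by
  unfold hform
  rw [star_sum]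
  simp only [star_sum, star_mul, star_star]
  rw [Finset.sum_comm]
  refine Finset.sum_congr rfl fun i _ => Finset.sum_congr rfl fun j _ => ?_
  rw [Matrix.IsHermitian.apply A.2, mul_assoc]

/-- The values `A(x, x)` are real, so that their sign is that of their real part. -/
lemma hform_self_eq_re {n : ℕ} (A : HyperHerm n) (x : Fin n → ℍ[ℝ]) :
    hform A x x = ((hform A x x).re : ℍ[ℝ]) :=
  Quaternion.star_eq_self.mp (star_hform A x x)

/-- `A` is positive definite: `A(x, x) > 0` for every non-zero vector `x`. -/
def IsPosDef {n : ℕ} (A : HyperHerm n) : Prop :=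
  ∀ x : Fin n → ℍ[ℝ], x ≠ 0 → 0 < (hform A x x).re

/-- `A` is non-negative definite: `A(x, x) ≥ 0` for every vector `x`. -/
def IsNonnegDef {n : ℕ} (A : HyperHerm n) : Prop :=
  ∀ x : Fin n → ℍ[ℝ], 0 ≤ (hform A x x).re

/-- The standard real basis `1, i, j, k` of the quaternions. -/
def quatUnit : Fin 4 → ℍ[ℝ] := ![⟨1, 0, 0, 0⟩, ⟨0, 1, 0, 0⟩, ⟨0, 0, 1, 0⟩, ⟨0, 0, 0, 1⟩]

/-- The `4n × 4n` real symmetric matrix of the real bilinear form `Re A(x, y)` on `ℍⁿ = ℝ⁴ⁿ`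
in the standard basis. -/
noncomputable def realMatrix {n : ℕ} (A : HyperHerm n) : Matrix (Fin n × Fin 4) (Fin n × Fin 4) ℝ :=
  Matrix.of fun p q =>
    (hform A (Pi.single p.1 (quatUnit p.2)) (Pi.single q.1 (quatUnit q.2))).re

/-- The algebra of real polynomial functions on a real vector space `V`: the algebra of functions
generated by the linear functionals. -/
def polyFun (V : Type*) [AddCommGroup V] [Module ℝ V] : Subalgebra ℝ (V → ℝ) :=
  Algebra.adjoin ℝ (Set.range fun (φ : V →ₗ[ℝ] ℝ) (v : V) => φ v)

/-- The defining properties of the Moore determinant: it is a polynomial `P` on the space of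
hyperhermitian matrices with `P(A)⁴ = det (realMatrix A)` and `P(Id) = 1`. -/
structure IsMooreDet {n : ℕ} (P : HyperHerm n → ℝ) : Prop where
  poly : P ∈ polyFun (HyperHerm n)
  pow_four : ∀ A, (realMatrix A).det = P A ^ 4
  id_eq_one : P (HyperHerm.id n) = 1

section Aux

lemma polyFun_linear {V : Type*} [AddCommGroup V] [Module ℝ V] (φ : V →ₗ[ℝ] ℝ) :
    (fun v => φ v) ∈ polyFun V :=
  Algebra.subset_adjoin ⟨φ, rfl⟩

/-- Along linear combinations of fixed vectors a polynomial function is given by exactly one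
polynomial in the coefficients. -/
lemma polyFun_comb {V : Type*} [AddCommGroup V] [Module ℝ V] {f : V → ℝ} (hf : f ∈ polyFun V)
    {k : ℕ} (v : Fin k → V) :
    ∃! q : MvPolynomial (Fin k) ℝ, ∀ l : Fin k → ℝ, MvPolynomial.eval l q = f (∑ i, l i • v i) := by
  refine existsUnique_of_exists_of_unique ?_ ?_
  · induction hf using Algebra.adjoin_induction with
    | mem f hf =>
      obtain ⟨φ, rfl⟩ := hf
      refine ⟨∑ i, MvPolynomial.C (φ (v i)) * MvPolynomial.X i, fun l => ?_⟩
      simp [map_sum, mul_comm]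
    | algebraMap r => exact ⟨MvPolynomial.C r, fun l => by simp [Pi.algebraMap_apply]⟩
    | add f g _ _ hf hg =>
      obtain ⟨p, hp⟩ := hf
      obtain ⟨q, hq⟩ := hg
      exact ⟨p + q, fun l => by simp [hp, hq]⟩
    | mul f g _ _ hf hg =>
      obtain ⟨p, hp⟩ := hf
      obtain ⟨q, hq⟩ := hg
      exact ⟨p * q, fun l => by simp [hp, hq]⟩
  · intro p q hp hq
    exact MvPolynomial.funext fun l => by rw [hp, hq]

lemma IsMooreDet.unique {n : ℕ} {P Q : HyperHerm n → ℝ} (hP : IsMooreDet P) (hQ : IsMooreDet Q) :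
    P = Q := by
  funext A
  obtain ⟨p, hp, -⟩ := polyFun_comb hP.poly ![HyperHerm.id n, A]
  obtain ⟨q, hq, -⟩ := polyFun_comb hQ.poly ![HyperHerm.id n, A]
  have h0 : (p - q) * (p + q) = 0 := by
    refine MvPolynomial.funext fun l => ?_
    have h4 := (hP.pow_four (∑ i, l i • ![HyperHerm.id n, A] i)).symm.trans
      (hQ.pow_four (∑ i, l i • ![HyperHerm.id n, A] i))
    rw [← hp l, ← hq l] at h4
    have h2 : (MvPolynomial.eval l p) ^ 2 = (MvPolynomial.eval l q) ^ 2 := by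
      have := sq_nonneg (MvPolynomial.eval l p)
      have := sq_nonneg (MvPolynomial.eval l q)
      exact (pow_left_inj₀ (sq_nonneg _) (sq_nonneg _) two_ne_zero).mp (by
        rw [← pow_mul, ← pow_mul]; exact h4)
    simp only [map_mul, map_sub, map_add, map_zero]
    linarith
  have e1p := hp ![1, 0]
  have e1q := hq ![1, 0]
  simp [Fin.sum_univ_two, hP.id_eq_one, hQ.id_eq_one] at e1p e1q
  have hpq : p = q := by
    rcases mul_eq_zero.mp h0 with h | h
    · exact sub_eq_zero.mp h
    · have := congrArg (MvPolynomial.eval ![1, 0]) h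
      simp [e1p, e1q] at this
  have e2p := hp ![0, 1]
  have e2q := hq ![0, 1]
  simp [Fin.sum_univ_two] at e2p e2q
  rw [← e2p, ← e2q, hpq]

lemma realMatrix_apply {n : ℕ} (A : HyperHerm n) (p q : Fin n × Fin 4) :
    realMatrix A p q = (star (quatUnit p.2) * A.1 p.1 q.1 * quatUnit q.2).re := by
  simp only [realMatrix, hform, Matrix.of_apply]
  rw [Finset.sum_eq_single p.1, Finset.sum_eq_single q.1]
  · simp
  · intro b _ hb
    simp [Pi.single_eq_of_ne hb]
  · simp
  · intro b _ hb
    simp [Pi.single_eq_of_ne hb]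
  · simp

lemma realMatrix_isHermitian {n : ℕ} (A : HyperHerm n) : (realMatrix A).IsHermitian := by
  ext p q
  simp only [Matrix.conjTranspose_apply, realMatrix, Matrix.of_apply, star_trivial]
  rw [← star_hform, Quaternion.re_star]

lemma re_star_quatUnit_mul (a : Fin 4) (x : ℍ[ℝ]) :
    (star (quatUnit a) * x).re = ![x.re, x.imI, x.imJ, x.imK] a := by
  have h1 : (quatUnit a).re = ![1, 0, 0, 0] a := by fin_cases a <;> rfl
  have h2 : (quatUnit a).imI = ![0, 1, 0, 0] a := by fin_cases a <;> rfl
  have h3 : (quatUnit a).imJ = ![0, 0, 1, 0] a := by fin_cases a <;> rfl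
  have h4 : (quatUnit a).imK = ![0, 0, 0, 1] a := by fin_cases a <;> rfl
  simp only [Quaternion.re_mul, Quaternion.re_star, Quaternion.imI_star, Quaternion.imJ_star,
    Quaternion.imK_star, h1, h2, h3, h4]
  fin_cases a <;> simp

lemma re_star_quatUnit_mul_quatUnit (a b : Fin 4) :
    (star (quatUnit a) * quatUnit b).re = if a = b then 1 else 0 := by
  rw [re_star_quatUnit_mul]
  fin_cases a <;> fin_cases b <;> rfl

lemma realMatrix_id (n : ℕ) : realMatrix (HyperHerm.id n) = 1 := by
  ext ⟨i, a⟩ ⟨j, b⟩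
  rw [realMatrix_apply]
  by_cases hij : i = j
  · subst hij
    simp only [HyperHerm.id, Matrix.one_apply_eq, mul_one, re_star_quatUnit_mul_quatUnit,
      Matrix.one_apply, Prod.mk.injEq, true_and]
  · simp [HyperHerm.id, hij]

/-- The real basis `1, i, j, k` of the quaternions. -/
noncomputable def quatBasis : Module.Basis (Fin 4) ℝ ℍ[ℝ] :=
  Module.Basis.ofEquivFun
    { toFun := fun q => ![q.re, q.imI, q.imJ, q.imK]
      invFun := fun v => ⟨v 0, v 1, v 2, v 3⟩
      left_inv := fun _ => rfl
      right_inv := fun v => by ext a; fin_cases a <;> rfl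
      map_add' := fun x y => by ext a; fin_cases a <;> rfl
      map_smul' := fun c x => by ext a; fin_cases a <;> rfl }

/-- The real basis of `ℍⁿ` used for `realMatrix`. -/
noncomputable def realBasis (n : ℕ) : Module.Basis (Fin n × Fin 4) ℝ (Fin n → ℍ[ℝ]) :=
  (Pi.basis fun _ : Fin n => quatBasis).reindex (Equiv.sigmaEquivProd (Fin n) (Fin 4))

lemma realBasis_repr {n : ℕ} (x : Fin n → ℍ[ℝ]) (p : Fin n × Fin 4) :
    (realBasis n).repr x p = (star (quatUnit p.2) * x p.1).re := by
  obtain ⟨i, a⟩ := p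
  rw [re_star_quatUnit_mul]
  simp only [realBasis, Module.Basis.repr_reindex_apply]
  exact Pi.basis_repr (fun _ : Fin n => quatBasis) x ⟨i, a⟩

lemma realBasis_apply {n : ℕ} (p : Fin n × Fin 4) :
    realBasis n p = Pi.single p.1 (quatUnit p.2) := by
  apply (realBasis n).repr.injective
  ext q
  rw [Module.Basis.repr_self, realBasis_repr]
  obtain ⟨i, a⟩ := p
  obtain ⟨j, b⟩ := q
  by_cases hij : i = j
  · subst hij
    simp only [Pi.single_eq_same, re_star_quatUnit_mul_quatUnit, Finsupp.single_apply,
      Prod.mk.injEq, true_and, eq_comm]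
  · simp [hij]

/-- Left multiplication of column vectors by `A - μ`, linear over the right scalars. -/
def rightLin {n : ℕ} (A : HyperHerm n) (μ : ℝ) : (Fin n → ℍ[ℝ]) →ₗ[ℍ[ℝ]ᵐᵒᵖ] (Fin n → ℍ[ℝ]) where
  toFun x := A.1.mulVec x - μ • x
  map_add' x y := by rw [Matrix.mulVec_add, smul_add]; abel
  map_smul' c x := by
    simp only [Matrix.mulVec_smul, RingHom.id_apply, smul_sub]
    rw [smul_comm]

lemma toMatrix_rightLin {n : ℕ} (A : HyperHerm n) :
    LinearMap.toMatrix (realBasis n) (realBasis n) ((rightLin A 0).restrictScalars ℝ) =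
      realMatrix A := by
  ext p q
  rw [LinearMap.toMatrix_apply, realBasis_repr, realMatrix_apply, realBasis_apply]
  simp [rightLin, mul_assoc]

lemma four_dvd_rootMultiplicity {n : ℕ} (A : HyperHerm n) (μ : ℝ) :
    4 ∣ (realMatrix A).charpoly.rootMultiplicity μ := by
  set T : Module.End ℝ (Fin n → ℍ[ℝ]) := (rightLin A 0).restrictScalars ℝ with hT
  rw [← toMatrix_rightLin A, LinearMap.charpoly_toMatrix, ← LinearMap.finrank_maxGenEigenspace_eq,
    Module.End.maxGenEigenspace_eq_genEigenspace_finrank, Module.End.genEigenspace_nat]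
  set k := Module.finrank ℝ (Fin n → ℍ[ℝ])
  let N : Module.End ℍ[ℝ]ᵐᵒᵖ (Fin n → ℍ[ℝ]) := rightLin A μ
  have hN : ∀ (m : ℕ) (x : Fin n → ℍ[ℝ]), ((T - μ • 1) ^ m) x = (N ^ m) x := by
    intro m
    induction m with
    | zero => intro x; simp
    | succ m ih =>
      intro x
      rw [pow_succ, pow_succ, Module.End.mul_apply, Module.End.mul_apply, ih]
      congr 1
      simp [hT, N, rightLin]
  have hker : LinearMap.ker ((T - μ • 1) ^ k) = (LinearMap.ker (N ^ k)).restrictScalars ℝ := by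
    ext x
    simp [hN]
  rw [hker]
  have h := Module.finrank_mul_finrank ℝ ℍ[ℝ]ᵐᵒᵖ (LinearMap.ker (N ^ k))
  have h4 : Module.finrank ℝ ℍ[ℝ]ᵐᵒᵖ = 4 := by
    rw [← Quaternion.finrank_eq_four (R := ℝ)]
    exact (MulOpposite.opLinearEquiv ℝ).finrank_eq.symm
  rw [h4] at h
  exact ⟨_, h.symm⟩

/-- The eigenvalues of `realMatrix A` are `n` real numbers, each repeated four times. -/
lemma exists_eigs {n : ℕ} (A : HyperHerm n) :
    ∃ l : Fin n → ℝ, (realMatrix A).charpoly.roots = 4 • (Finset.univ.val.map l) := by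
  set s := (realMatrix A).charpoly.roots with hs
  have hdvd : ∀ a, 4 ∣ s.count a := fun a => by
    rw [hs, Polynomial.count_roots]; exact four_dvd_rootMultiplicity A a
  let t : Multiset ℝ := ∑ a ∈ s.toFinset, (s.count a / 4) • {a}
  have ht : s = 4 • t := by
    conv_lhs => rw [← Multiset.toFinset_sum_count_nsmul_eq s]
    rw [Finset.smul_sum]
    refine Finset.sum_congr rfl fun a _ => ?_
    rw [smul_smul, Nat.mul_div_cancel' (hdvd a)]
  have hcard : s.card = 4 * n := by
    have h := (realMatrix_isHermitian A).splits_charpoly.natDegree_eq_card_roots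
    rw [Matrix.charpoly_natDegree_eq_dim] at h
    rw [hs, ← h]
    simp [mul_comm]
  have htn : t.card = n := by
    rw [ht, Multiset.card_nsmul] at hcard
    simpa using hcard
  refine ⟨fun i => t.toList.get (i.cast (by simp [htn])), ?_⟩
  rw [ht]
  congr 1
  rw [Fin.univ_val_map]
  conv_lhs => rw [← Multiset.coe_toList t]
  congr 1
  apply List.ext_get
  · simp [htn]
  · intro i h1 h2
    simp

/-- The eigenvalues of `A`. -/
noncomputable def eigs {n : ℕ} (A : HyperHerm n) : Fin n → ℝ := (exists_eigs A).choose

lemma roots_eq_eigs {n : ℕ} (A : HyperHerm n) :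
    (realMatrix A).charpoly.roots = 4 • (Finset.univ.val.map (eigs A)) :=
  (exists_eigs A).choose_spec

lemma trace_pow_eq {n : ℕ} (A : HyperHerm n) (k : ℕ) :
    (realMatrix A ^ k).trace = 4 * ∑ i, eigs A i ^ k := by
  have hA := realMatrix_isHermitian A
  have h1 : (realMatrix A ^ k).trace = ∑ p, hA.eigenvalues p ^ k := by
    conv_lhs => rw [hA.spectral_theorem]
    rw [← map_pow, Unitary.conjStarAlgAut_apply, Matrix.trace_mul_cycle]
    simp [Matrix.diagonal_pow, Matrix.trace_diagonal]
  have h2 : (Finset.univ.val.map hA.eigenvalues) = 4 • (Finset.univ.val.map (eigs A)) := by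
    rw [← roots_eq_eigs, hA.roots_charpoly_eq_eigenvalues]
    simp
  have h3 := congrArg (fun s => (s.map (fun x : ℝ => x ^ k)).sum) h2
  simp only [Multiset.map_nsmul, Multiset.sum_nsmul, Multiset.map_map] at h3
  rw [h1]
  exact h3.trans (by rw [nsmul_eq_mul]; rfl)

lemma det_eq_eigs {n : ℕ} (A : HyperHerm n) :
    (realMatrix A).det = (∏ i, eigs A i) ^ 4 := by
  have hA := realMatrix_isHermitian A
  rw [Matrix.det_eq_prod_roots_charpoly_of_splits hA.splits_charpoly, roots_eq_eigs,
    Multiset.prod_nsmul]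
  rfl

lemma realMatrix_entry_mem {n : ℕ} (p q : Fin n × Fin 4) :
    (fun A : HyperHerm n => realMatrix A p q) ∈ polyFun (HyperHerm n) := by
  let φ : HyperHerm n →ₗ[ℝ] ℝ :=
    { toFun := fun A => realMatrix A p q
      map_add' := fun A B => by simp only [realMatrix_apply]; simp [mul_add, add_mul]
      map_smul' := fun c A => by
        simp only [realMatrix_apply]
        simp only [Submodule.coe_smul, Matrix.smul_apply, mul_smul_comm, smul_mul_assoc,
          Quaternion.re_smul, RingHom.id_apply] }
  exact polyFun_linear φ

lemma realMatrix_pow_entry_mem {n : ℕ} (k : ℕ) (p q : Fin n × Fin 4) :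
    (fun A : HyperHerm n => (realMatrix A ^ k) p q) ∈ polyFun (HyperHerm n) := by
  induction k generalizing q with
  | zero => 
    simp only [pow_zero]
    exact (polyFun (HyperHerm n)).algebraMap_mem ((1 : Matrix _ _ ℝ) p q)
  | succ k ih =>
    have : (fun A : HyperHerm n => (realMatrix A ^ (k + 1)) p q) =
        ∑ r, (fun A : HyperHerm n => (realMatrix A ^ k) p r) *
          (fun A : HyperHerm n => realMatrix A r q) := by
      funext A
      simp [pow_succ, Matrix.mul_apply]
    rw [this]
    exact Subalgebra.sum_mem _ fun r _ => Subalgebra.mul_mem _ (ih r) (realMatrix_entry_mem r q)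

lemma psum_eigs_mem {n : ℕ} (k : ℕ) :
    (fun A : HyperHerm n => MvPolynomial.eval (eigs A) (MvPolynomial.psum (Fin n) ℝ k)) ∈
      polyFun (HyperHerm n) := by
  have : (fun A : HyperHerm n => MvPolynomial.eval (eigs A) (MvPolynomial.psum (Fin n) ℝ k)) =
      (1 / 4 : ℝ) • ∑ p, (fun A : HyperHerm n => (realMatrix A ^ k) p p) := by
    funext A
    have h := trace_pow_eq A k
    simp only [Matrix.trace, Matrix.diag_apply] at h
    simp [MvPolynomial.psum, h]
  rw [this]
  exact Subalgebra.smul_mem _ (Subalgebra.sum_mem _ fun p _ => realMatrix_pow_entry_mem k p p) _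

lemma esymm_eigs_mem {n : ℕ} (k : ℕ) :
    (fun A : HyperHerm n => MvPolynomial.eval (eigs A) (MvPolynomial.esymm (Fin n) ℝ k)) ∈
      polyFun (HyperHerm n) := by
  induction k using Nat.strong_induction_on with
  | _ k ih =>
    rcases Nat.eq_zero_or_pos k with rfl | hk
    · simp only [MvPolynomial.esymm_zero, map_one]
      exact Subalgebra.one_mem _
    have hk0 : (k : ℝ) ≠ 0 := by positivity
    have : (fun A : HyperHerm n => MvPolynomial.eval (eigs A) (MvPolynomial.esymm (Fin n) ℝ k)) =
        ((k : ℝ)⁻¹ * (-1) ^ (k + 1)) • ∑ a ∈ Finset.HasAntidiagonal.antidiagonal k with a.1 < k, ((-1 : ℝ) ^ a.1) •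
          ((fun A : HyperHerm n => MvPolynomial.eval (eigs A) (MvPolynomial.esymm (Fin n) ℝ a.1)) *
           (fun A : HyperHerm n => MvPolynomial.eval (eigs A) (MvPolynomial.psum (Fin n) ℝ a.2))) := by
      funext A
      have h := congrArg (MvPolynomial.eval (eigs A)) (MvPolynomial.mul_esymm_eq_sum (Fin n) ℝ k)
      simp only [map_mul, map_natCast, map_sum, map_pow, map_neg, map_one] at h
      simp only [Pi.smul_apply, Finset.sum_apply, Pi.mul_apply, smul_eq_mul]
      rw [mul_assoc, eq_inv_mul_iff_mul_eq₀ hk0, h]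
      simp only [mul_assoc]
    rw [this]
    refine Subalgebra.smul_mem _ (Subalgebra.sum_mem _ fun a ha => Subalgebra.smul_mem _
      (Subalgebra.mul_mem _ (ih a.1 (Finset.mem_filter.mp ha).2) (psum_eigs_mem a.2)) _) _

lemma eigs_id {n : ℕ} (i : Fin n) : eigs (HyperHerm.id n) i = 1 := by
  have h : eigs (HyperHerm.id n) i ∈ (realMatrix (HyperHerm.id n)).charpoly.roots := by
    rw [roots_eq_eigs, Multiset.mem_nsmul]
    exact ⟨four_ne_zero, Multiset.mem_map_of_mem _ (Finset.mem_univ_val i)⟩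
  have h0 := (Polynomial.mem_roots'.mp h).2
  rw [realMatrix_id, Matrix.charpoly_one, Polynomial.IsRoot.def, Polynomial.eval_pow] at h0
  have := eq_zero_of_pow_eq_zero h0
  simp at this
  linarith

theorem existsUnique_mooreDet (n : ℕ) : ∃! P : HyperHerm n → ℝ, IsMooreDet P := by
  refine existsUnique_of_exists_of_unique ⟨fun A => ∏ i, eigs A i, ?_, det_eq_eigs, ?_⟩
    fun P Q hP hQ => hP.unique hQ
  · have := esymm_eigs_mem (n := n) n
    have hu : Finset.powersetCard n (Finset.univ : Finset (Fin n)) = {Finset.univ} := by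
      have h := Finset.powersetCard_self (Finset.univ : Finset (Fin n))
      rwa [Finset.card_fin] at h
    simpa [MvPolynomial.esymm, hu] using this
  · simp [eigs_id]

end Aux

/-- The Moore determinant of a hyperhermitian matrix: the unique polynomial with the properties
listed in `IsMooreDet`. -/
noncomputable def mooreDet {n : ℕ} : HyperHerm n → ℝ := (existsUnique_mooreDet n).choose

lemma isMooreDet_mooreDet (n : ℕ) : IsMooreDet (mooreDet (n := n)) :=
  (existsUnique_mooreDet n).choose_spec.1

/-- The polynomial `det (λ₁ A₁ + ⋯ + λₙ Aₙ)` in the real variables `λ₁, …, λₙ`. -/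
noncomputable def pencilPoly {n : ℕ} (A : Fin n → HyperHerm n) : MvPolynomial (Fin n) ℝ :=
  (polyFun_comb (isMooreDet_mooreDet n).poly A).choose

lemma eval_pencilPoly {n : ℕ} (A : Fin n → HyperHerm n) (l : Fin n → ℝ) :
    MvPolynomial.eval l (pencilPoly A) = mooreDet (∑ i, l i • A i) :=
  (polyFun_comb (isMooreDet_mooreDet n).poly A).choose_spec.1 l

/-- The mixed discriminant `det (A₁, …, Aₙ)`: the coefficient of `λ₁ ⋯ λₙ` in
`det (λ₁ A₁ + ⋯ + λₙ Aₙ)`, divided by `n!`. -/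
noncomputable def mixedDisc {n : ℕ} (A : Fin n → HyperHerm n) : ℝ :=
  (pencilPoly A).coeff (∑ i, Finsupp.single i 1) / (n.factorial : ℝ)

end QuatMoore

/-! In real coordinates the Moore determinant is a polynomial that is stable with respect to the
positive definite cone: it has no zero at X + iY with Y positive definite. Its fourth power there is
the determinant of the complex matrix S + iT, where S, T are the real matrices of X, Y, and this is
invertible because T is positive definite (`isStable_moorePoly`).

Stability survives differentiation in a direction of the cone, by the Gauss–Lucas theorem
(`IsStable.dirD`), and n! times the mixed discriminant is an n-fold directional derivative
(`mixedDisc_eq`). Differentiating n times leaves a stable polynomial of degree 0, a positive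
constant, which is (i); the non-negative case is a limit. Differentiating n - 2 times leaves a
stable quadratic polynomial, whose Hessian is proportional to B. If x is B-orthogonal to e in the
cone and B(x, x) > 0, then the quadratic vanishes at x + ice for a suitable c > 0, contrary to
stability. Hence B is nonpositive on the orthogonal complement of e
(`IsStable.hessForm_isLorentzian`), so it has exactly one plus.

For non-degeneracy, a vector X in the radical is annihilated by the quadratic derivative. The cone
directions are removed one by one: for stable p of degree at least 3, D_a D_X p = 0 implies D_X p =
0 (`IsStable.dirD_eq_zero_of_dirD`), which reduces to cubics and the equality case for Lorentzian
forms. In the end the Moore determinant is invariant under translation by X, so every eigenvalue of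
X is zero and X = 0. -/

namespace MvPolynomial

/-! ### Directional derivatives and restriction to complex lines. -/

variable {σ : Type*}

/-- The derivative of a polynomial in the constant direction `a`. -/
noncomputable def dirD (a : σ → ℝ) : Derivation ℝ (MvPolynomial σ ℝ) (MvPolynomial σ ℝ) :=
  mkDerivation ℝ fun i => C (a i)

@[simp]
lemma dirD_X (a : σ → ℝ) (i : σ) : dirD a (X i) = C (a i) :=
  mkDerivation_X _ _ _

lemma dirD_add (a b : σ → ℝ) (p : MvPolynomial σ ℝ) : dirD (a + b) p = dirD a p + dirD b p := by
  have : dirD (a + b) = dirD a + dirD b := derivation_ext fun i => by simp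
  rw [this, Derivation.add_apply]

lemma dirD_smul (c : ℝ) (a : σ → ℝ) (p : MvPolynomial σ ℝ) : dirD (c • a) p = c • dirD a p := by
  have : dirD (c • a) = c • dirD a := derivation_ext fun i => by simp [smul_eq_C_mul]
  rw [this, Derivation.smul_apply]

lemma dirD_comm (a b : σ → ℝ) (p : MvPolynomial σ ℝ) :
    dirD a (dirD b p) = dirD b (dirD a p) := by
  have : ⁅dirD a, dirD b⁆ = 0 := derivation_ext fun i => by simp [Derivation.commutator_apply]
  have h := congrArg (fun D : Derivation ℝ (MvPolynomial σ ℝ) (MvPolynomial σ ℝ) => D p) this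
  simpa [Derivation.commutator_apply, sub_eq_zero] using h

lemma dirD_eq_sum [Fintype σ] (a : σ → ℝ) (p : MvPolynomial σ ℝ) :
    dirD a p = ∑ i, C (a i) * pderiv i p := by
  classical
  have : dirD a = ∑ i, C (a i) • pderiv i := derivation_ext fun j => by
    rw [← Derivation.coeFnAddMonoidHom_apply (∑ i : σ, (C (a i) : MvPolynomial σ ℝ) • pderiv i), map_sum]
    simp [Finset.sum_apply, pderiv_X, Pi.single_apply]
  rw [this, ← Derivation.coeFnAddMonoidHom_apply, map_sum]
  simp

lemma IsHomogeneous.dirD [Fintype σ] {p : MvPolynomial σ ℝ} {n : ℕ} (hp : p.IsHomogeneous n)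
    (a : σ → ℝ) : (dirD a p).IsHomogeneous (n - 1) := by
  rw [dirD_eq_sum]
  exact IsHomogeneous.sum _ _ _ fun i _ => hp.pderiv.C_mul _

lemma IsHomogeneous.eval_dirD_self [Fintype σ] {p : MvPolynomial σ ℝ} {n : ℕ}
    (hp : p.IsHomogeneous n) (x : σ → ℝ) : eval x (MvPolynomial.dirD x p) = n * eval x p := by
  have h := congrArg (eval x) hp.sum_X_mul_pderiv
  rw [dirD_eq_sum]
  simpa using h

lemma IsHomogeneous.aeval_mul {A : Type*} [CommRing A] [Algebra ℝ A] {p : MvPolynomial σ ℝ}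
    {n : ℕ} (hp : p.IsHomogeneous n) (s : A) (z : σ → A) :
    MvPolynomial.aeval (fun i => s * z i) p = s ^ n * MvPolynomial.aeval z p := by
  rw [aeval_def, aeval_def, eval₂_eq, eval₂_eq, Finset.mul_sum]
  refine Finset.sum_congr rfl fun d hd => ?_
  have hdeg := hp.degree_eq_sum_deg_support hd
  simp only [mul_pow, Finset.prod_mul_distrib, Finset.prod_pow_eq_pow_sum]
  rw [hdeg]
  ring

/-- The chain rule along a map whose coordinates have constant derivatives. -/
lemma derivation_aeval {A : Type*} [CommRing A] [Algebra ℝ A] (δ : Derivation ℝ A A)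
    (φ : σ → A) (a : σ → ℝ) (h : ∀ i, δ (φ i) = algebraMap ℝ A (a i)) (p : MvPolynomial σ ℝ) :
    δ (aeval φ p) = aeval φ (dirD a p) := by
  induction p using MvPolynomial.induction_on with
  | C r => simp
  | add p q hp hq => simp [hp, hq]
  | mul_X p i hp => simp [hp, h]

lemma IsHomogeneous.eq_C {p : MvPolynomial σ ℝ} (hp : p.IsHomogeneous 0) (x : σ → ℝ) :
    p = C (eval x p) := by
  rw [← totalDegree_zero_iff_isHomogeneous, totalDegree_eq_zero_iff_eq_C] at hp
  rw [hp]; simp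

/-- The restriction of a real polynomial to the complex line `z + s a`. -/
noncomputable def line (z : σ → ℂ) (a : σ → ℝ) : MvPolynomial σ ℝ →ₐ[ℝ] Polynomial ℂ :=
  aeval fun i => Polynomial.C (z i) + Polynomial.C (a i : ℂ) * Polynomial.X

lemma eval_line (z : σ → ℂ) (a : σ → ℝ) (p : MvPolynomial σ ℝ) (s : ℂ) :
    (line z a p).eval s = aeval (fun i => z i + s * a i) p := by
  have : ((Polynomial.aeval s).restrictScalars ℝ : Polynomial ℂ →ₐ[ℝ] ℂ).comp (line z a) =
      aeval fun i => z i + s * a i := algHom_ext fun i => by simp [line, mul_comm s]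
  have h := DFunLike.congr_fun this p
  simpa [Polynomial.coe_aeval_eq_eval] using h

lemma derivative_line (z : σ → ℂ) (a : σ → ℝ) (p : MvPolynomial σ ℝ) :
    Polynomial.derivative (line z a p) = line z a (dirD a p) := by
  have hX (i : σ) : line z a (X i) = Polynomial.C (z i) + Polynomial.C (a i : ℂ) * Polynomial.X :=
    aeval_X _ _
  have hC (r : ℝ) : line z a (C r) = Polynomial.C (r : ℂ) := aeval_C _ _
  induction p using MvPolynomial.induction_on with
  | C r => simp only [hC, Polynomial.derivative_C, derivation_C, map_zero]
  | add p q hp hq => simp only [map_add, hp, hq]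
  | mul_X p i hp =>
    simp only [map_mul, Polynomial.derivative_mul, hp, hX, hC, Derivation.leibniz, dirD_X,
      smul_eq_mul, map_add, Polynomial.derivative_C, Polynomial.derivative_X]
    ring

lemma aeval_ofReal (x : σ → ℝ) (p : MvPolynomial σ ℝ) :
    aeval (fun i => (x i : ℂ)) p = ((eval x p : ℝ) : ℂ) := by
  have := aeval_algebraMap_apply ℂ x p
  simpa [aeval_eq_eval, Function.comp_def] using this

end MvPolynomial

/-! ### Stable polynomials on open convex cones. -/

/-- A non-empty algebraically open convex cone. -/
structure IsOpenConvexCone {V : Type*} [AddCommGroup V] [Module ℝ V] (K : Set V) : Prop where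
  nonempty : K.Nonempty
  smul_mem : ∀ {y : V}, y ∈ K → ∀ {t : ℝ}, 0 < t → t • y ∈ K
  add_mem : ∀ {y a : V}, y ∈ K → a ∈ K → y + a ∈ K
  exists_add_smul_mem : ∀ {a : V}, a ∈ K → ∀ x, ∃ ε : ℝ, 0 < ε ∧ a + ε • x ∈ K

lemma IsOpenConvexCone.eq_zero_of_forall_mem {V W : Type*} [AddCommGroup V] [Module ℝ V]
    [AddCommGroup W] [Module ℝ W] {K : Set V} (hK : IsOpenConvexCone K) (φ : V →ₗ[ℝ] W)
    (h : ∀ y ∈ K, φ y = 0) : φ = 0 := by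
  ext x
  obtain ⟨a, ha⟩ := hK.nonempty
  obtain ⟨ε, hε, hm⟩ := hK.exists_add_smul_mem ha x
  have h1 := h _ hm
  rw [map_add, h a ha, zero_add, map_smul] at h1
  exact (smul_eq_zero.mp h1).resolve_left hε.ne'

/-- A homogeneous polynomial that is positive on the cone `K` and has no zeros with imaginary part
in `K`. -/
structure IsStable {σ : Type*} (K : Set (σ → ℝ)) (n : ℕ) (p : MvPolynomial σ ℝ) : Prop where
  homog : p.IsHomogeneous n
  ne_zero : ∀ x : σ → ℝ, ∀ y ∈ K,
    MvPolynomial.aeval (fun i => (x i : ℂ) + Complex.I * (y i : ℂ)) p ≠ 0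
  pos : ∀ y ∈ K, 0 < MvPolynomial.eval y p

namespace IsStable

open MvPolynomial

variable {σ : Type*} {K : Set (σ → ℝ)} {n : ℕ} {p : MvPolynomial σ ℝ}

/-- A constant restriction c would give p(a + uz) = c u^(n+1) for u ≠ 0 by homogeneity. Both sides
are polynomials in u, so u = 0 yields p(a) = 0, against positivity on the cone. -/
lemma line_natDegree_pos (h : IsStable K (n + 1) p) {a : σ → ℝ} (ha : a ∈ K) (z : σ → ℂ) :
    0 < (line z a p).natDegree := by
  by_contra hd
  obtain ⟨c, hc⟩ := Polynomial.natDegree_eq_zero.mp (Nat.eq_zero_of_not_pos hd)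
  have hz (s : ℂ) : aeval (fun i => z i + s * a i) p = c := by
    rw [← eval_line, ← hc, Polynomial.eval_C]
  let g : Polynomial ℂ := aeval (fun i => Polynomial.C (a i : ℂ) + Polynomial.C (z i) * Polynomial.X) p
  have hg (u : ℂ) : g.eval u = aeval (fun i => a i + z i * u) p := by
    have : ((Polynomial.aeval u).restrictScalars ℝ : Polynomial ℂ →ₐ[ℝ] ℂ).comp (aeval
        fun i => Polynomial.C (a i : ℂ) + Polynomial.C (z i) * Polynomial.X) =
        aeval fun i => a i + z i * u := algHom_ext fun i => by simp
    simpa [Polynomial.coe_aeval_eq_eval] using DFunLike.congr_fun this p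
  have hgX : g = Polynomial.C c * Polynomial.X ^ (n + 1) := by
    refine Polynomial.eq_of_infinite_eval_eq _ _ ?_
    refine Set.Infinite.mono (s := {0}ᶜ) (fun u hu => ?_) (Set.finite_singleton (0 : ℂ)).infinite_compl
    have hu0 : u ≠ 0 := hu
    have : (fun i => (a i : ℂ) + z i * u) = fun i => u * (z i + u⁻¹ * a i) := by
      ext i
      field_simp
      ring
    rw [Set.mem_ofPred_eq, hg, this, h.homog.aeval_mul, hz]
    simp [mul_comm c]
  have h0 : g.eval 0 = 0 := by simp [hgX]
  rw [hg] at h0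
  simp only [mul_zero, add_zero, aeval_ofReal] at h0
  exact (h.pos a ha).ne' (by exact_mod_cast h0)

/-- Gauss–Lucas: the roots of s ↦ p(z + sa) have Im s < 0, since otherwise z + sa would still have
imaginary part y + (Im s)a in the cone. The roots of the derivative lie in the same open half-plane,
so 0 is not among them. -/
lemma dirD_ne_zero (hK : IsOpenConvexCone K) (h : IsStable K (n + 1) p) {a : σ → ℝ} (ha : a ∈ K)
    (x : σ → ℝ) {y : σ → ℝ} (hy : y ∈ K) :
    aeval (fun i => (x i : ℂ) + Complex.I * (y i : ℂ)) (MvPolynomial.dirD a p) ≠ 0 := by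
  intro h0
  set z : σ → ℂ := fun i => (x i : ℂ) + Complex.I * (y i : ℂ)
  have hroot : (0 : ℂ) ∈ (line z a p).derivative.rootSet ℂ := by
    rw [Polynomial.mem_rootSet]
    refine ⟨fun hd => ?_, ?_⟩
    · exact (h.line_natDegree_pos ha z).ne' (Polynomial.derivative_eq_zero.mp hd)
    · rw [Polynomial.coe_aeval_eq_eval, derivative_line, eval_line]
      simpa using h0
  have hsub : (line z a p).rootSet ℂ ⊆ {s | s.im < 0} := by
    intro s hs
    rw [Polynomial.mem_rootSet, Polynomial.coe_aeval_eq_eval, eval_line] at hs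
    by_contra him
    simp only [Set.mem_ofPred_eq, not_lt] at him
    have hm : y + s.im • a ∈ K := by
      rcases him.eq_or_lt with h | h
      · simpa [← h] using hy
      · exact hK.add_mem hy (hK.smul_mem ha h)
    refine h.ne_zero (x + s.re • a) _ hm ?_
    rw [← hs.2]
    congr 2
    ext i
    simp only [z, Pi.add_apply, Pi.smul_apply, smul_eq_mul]
    conv_rhs => rw [← Complex.re_add_im s]
    push_cast
    ring
  have hmem := convexHull_min hsub (convex_halfSpace_im_lt 0)
    (Polynomial.rootSet_derivative_subset_convexHull_rootSet
      (Polynomial.natDegree_pos_iff_degree_pos.mp (h.line_natDegree_pos ha z)) hroot)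
  simp at hmem

/-- Intermediate value theorem on the segment from a to y, which stays in the cone. -/
lemma pos_of_ne_zero (hK : IsOpenConvexCone K) (hn : ∀ y ∈ K, eval y p ≠ 0) {a : σ → ℝ}
    (ha : a ∈ K) (h0 : 0 < eval a p) {y : σ → ℝ} (hy : y ∈ K) : 0 < eval y p := by
  by_contra hneg
  have hcont : Continuous fun t : ℝ => eval ((1 - t) • a + t • y) p :=
    (MvPolynomial.continuous_eval p).comp (by fun_prop)
  obtain ⟨t, ht, hz⟩ := intermediate_value_Icc' zero_le_one hcont.continuousOn
    (show (0 : ℝ) ∈ _ by simpa using ⟨not_lt.mp hneg, h0.le⟩)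
  refine hn _ ?_ hz
  rcases ht.1.eq_or_lt with h | h
  · simpa [← h] using ha
  rcases ht.2.eq_or_lt with h' | h'
  · simpa [h'] using hy
  · exact hK.add_mem (hK.smul_mem ha (sub_pos.mpr h')) (hK.smul_mem hy h)

/-- Homogeneity gives p(iy) = iⁿ p(y). -/
lemma eval_ne_zero_of_forall_aeval_ne_zero (hp : p.IsHomogeneous n)
    (h : ∀ x : σ → ℝ, ∀ y ∈ K, aeval (fun i => (x i : ℂ) + Complex.I * (y i : ℂ)) p ≠ 0)
    {y : σ → ℝ} (hy : y ∈ K) : eval y p ≠ 0 := by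
  intro h0
  have := h 0 y hy
  simp only [Pi.zero_apply, Complex.ofReal_zero, zero_add, hp.aeval_mul, aeval_ofReal, h0] at this
  simp at this

protected lemma dirD [Fintype σ] (hK : IsOpenConvexCone K) (h : IsStable K (n + 1) p) {a : σ → ℝ}
    (ha : a ∈ K) : IsStable K n (MvPolynomial.dirD a p) where
  homog := h.homog.dirD a
  ne_zero x _ hy := h.dirD_ne_zero hK ha x hy
  pos y hy := by
    refine pos_of_ne_zero hK (fun y hy => eval_ne_zero_of_forall_aeval_ne_zero (h.homog.dirD a)
      (fun x y hy => h.dirD_ne_zero hK ha x hy) hy) ha ?_ hy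
    -- Euler's identity gives the sign at one point of the cone: D_a p(a) = (n + 1) p(a).
    rw [h.homog.eval_dirD_self]
    have := h.pos a ha
    positivity

end IsStable

/-! ### Iterated derivatives and Hessian forms. -/

namespace MvPolynomial

variable {σ : Type*}

/-- The directional derivative of `p` as a linear function of the direction. -/
noncomputable def dirDLin (p : MvPolynomial σ ℝ) : (σ → ℝ) →ₗ[ℝ] MvPolynomial σ ℝ where
  toFun b := dirD b p
  map_add' a b := dirD_add a b p
  map_smul' c a := dirD_smul c a p

lemma dirDLin_apply (p : MvPolynomial σ ℝ) (b : σ → ℝ) : dirDLin p b = dirD b p := rfl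

/-- Iterated directional derivatives. -/
noncomputable def iterD (L : List (σ → ℝ)) (p : MvPolynomial σ ℝ) : MvPolynomial σ ℝ :=
  L.foldr (fun a q => dirD a q) p

@[simp]
lemma iterD_nil (p : MvPolynomial σ ℝ) : iterD [] p = p := rfl

@[simp]
lemma iterD_cons (a : σ → ℝ) (L : List (σ → ℝ)) (p : MvPolynomial σ ℝ) :
    iterD (a :: L) p = dirD a (iterD L p) := rfl

lemma iterD_dirD (L : List (σ → ℝ)) (a : σ → ℝ) (p : MvPolynomial σ ℝ) :
    iterD L (dirD a p) = dirD a (iterD L p) := by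
  induction L with
  | nil => rfl
  | cons b L ih => rw [iterD_cons, ih, dirD_comm, iterD_cons]

/-- The second derivative at the origin, as a bilinear form. -/
noncomputable def hessForm (q : MvPolynomial σ ℝ) : LinearMap.BilinForm ℝ (σ → ℝ) :=
  LinearMap.mk₂ ℝ (fun x y => eval 0 (dirD x (dirD y q)))
    (fun x x' y => by rw [dirD_add, map_add])
    (fun c x y => by rw [dirD_smul, smul_eval, smul_eq_mul])
    (fun x y y' => by rw [dirD_add, map_add, map_add])
    (fun c x y => by rw [dirD_smul, Derivation.map_smul, smul_eval, smul_eq_mul])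

@[simp]
lemma hessForm_apply (q : MvPolynomial σ ℝ) (x y : σ → ℝ) :
    hessForm q x y = eval 0 (dirD x (dirD y q)) := rfl

lemma isSymm_hessForm (q : MvPolynomial σ ℝ) : (hessForm q).IsSymm :=
  ⟨fun x y => by simp [dirD_comm x y]⟩

lemma IsHomogeneous.eval_dirD_eq_hessForm [Fintype σ] {q : MvPolynomial σ ℝ}
    (hq : q.IsHomogeneous 2) (x y : σ → ℝ) :
    eval x (MvPolynomial.dirD y q) = hessForm q x y := by
  have h1 := (hq.dirD y).eval_dirD_self x
  rw [((hq.dirD y).dirD x).eq_C 0, eval_C] at h1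
  simpa using h1.symm

lemma IsHomogeneous.eval_eq_hessForm [Fintype σ] {q : MvPolynomial σ ℝ}
    (hq : q.IsHomogeneous 2) (x : σ → ℝ) : eval x q = hessForm q x x / 2 := by
  rw [← hq.eval_dirD_eq_hessForm, hq.eval_dirD_self]
  simp

/-- Taylor expansion along the line, with the coefficients read off from its derivatives. -/
lemma IsHomogeneous.aeval_add_smul [Fintype σ] {q : MvPolynomial σ ℝ} (hq : q.IsHomogeneous 2)
    (x e : σ → ℝ) (s : ℂ) :
    MvPolynomial.aeval (fun i => (x i : ℂ) + s * e i) q =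
      (hessForm q x x / 2 : ℝ) + s * (hessForm q x e : ℝ) + s ^ 2 * (hessForm q e e / 2 : ℝ) := by
  set z : σ → ℂ := fun i => (x i : ℂ) with hz
  have hC : (line z e q).derivative.derivative = Polynomial.C ((hessForm q e e : ℝ) : ℂ) := by
    rw [derivative_line, derivative_line, ((hq.dirD e).dirD e).eq_C 0]
    exact aeval_C _ _
  have h0 : (line z e q).coeff 0 = (hessForm q x x / 2 : ℝ) := by
    rw [Polynomial.coeff_zero_eq_eval_zero, eval_line]
    simp only [zero_mul, add_zero, hz, aeval_ofReal, hq.eval_eq_hessForm]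
  have h1 : (line z e q).coeff 1 = (hessForm q x e : ℝ) := by
    have h : (line z e q).derivative.coeff 0 = (hessForm q x e : ℝ) := by
      rw [Polynomial.coeff_zero_eq_eval_zero, derivative_line, eval_line]
      simp only [zero_mul, add_zero, hz, aeval_ofReal, hq.eval_dirD_eq_hessForm]
    simpa [Polynomial.coeff_derivative] using h
  have hk (k : ℕ) : (line z e q).coeff (k + 2) * ((k + 2) * (k + 1)) =
      (Polynomial.C ((hessForm q e e : ℝ) : ℂ)).coeff k := by
    rw [← hC, Polynomial.coeff_derivative, Polynomial.coeff_derivative]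
    push_cast
    ring
  have h2 : (line z e q).coeff 2 = (hessForm q e e / 2 : ℝ) := by
    have := hk 0
    simp only [Polynomial.coeff_C_zero, zero_add, Nat.cast_zero, mul_one] at this
    push_cast
    rw [← this]
    ring
  have hdeg : (line z e q).natDegree < 3 := by
    rw [Nat.lt_succ_iff, Polynomial.natDegree_le_iff_coeff_eq_zero]
    intro N hN
    obtain ⟨k, rfl⟩ := Nat.exists_eq_add_of_le' hN
    have := hk (k + 1)
    rw [Polynomial.coeff_C_succ] at this
    refine (mul_eq_zero.mp this).resolve_right ?_
    norm_cast
  rw [← eval_line, Polynomial.eval_eq_sum_range' hdeg, Finset.sum_range_succ,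
    Finset.sum_range_succ, Finset.sum_range_one, h0, h1, h2]
  ring

end MvPolynomial

/-! ### Lorentzian forms. -/

/-- A bilinear form with the properties of a form with one positive square, relative to the
vector `e`. -/
structure LinearMap.BilinForm.IsLorentzian {V : Type*} [AddCommGroup V] [Module ℝ V]
    (B : LinearMap.BilinForm ℝ V) (e : V) : Prop where
  isSymm : B.IsSymm
  pos : 0 < B e e
  nonpos : ∀ x, B e x = 0 → B x x ≤ 0

namespace LinearMap.BilinForm.IsLorentzian

variable {V : Type*} [AddCommGroup V] [Module ℝ V] {B : LinearMap.BilinForm ℝ V} {e : V}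

/-- The equality case: a null vector orthogonal to `e` is in the radical. -/
lemma apply_eq_zero (h : B.IsLorentzian e) {x : V} (hx : B e x = 0) (hxx : B x x = 0) (y : V) :
    B x y = 0 := by
  have hs (u v : V) : B u v = B v u := h.isSymm.eq u v
  -- y' is the component of y orthogonal to e; as x is orthogonal to e, replacing y by y' does not
  -- change B x y.
  set c := B e y / B e e
  set y' := y - c • e
  have hxe : B x e = 0 := by rw [hs, hx]
  have hy : B e y' = 0 := by
    simp only [y', c, map_sub, map_smul, smul_eq_mul]
    field_simp [h.pos.ne']
    ring
  have hxy : B x y = B x y' := by simp [y', hxe]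
  rw [hxy]
  have hq (s : ℝ) : 2 * s * B x y' + B y' y' * s ^ 2 ≤ 0 := by
    have := h.nonpos (x + s • y') (by simp [hx, hy])
    simp only [map_add, map_smul, LinearMap.add_apply, LinearMap.smul_apply, smul_eq_mul, hxx,
      hs y' x] at this
    linarith
  have hyy := h.nonpos y' hy
  by_contra hne
  -- With d = B y' y' ≤ 0, this s satisfies B x y' = s(1 - d), so the expression becomes s²(2 - d) >
  -- 0. The 1 keeps the denominator positive when d = 0.
  have h1 := hq (B x y' / (1 - B y' y'))
  have hpos : 0 < 1 - B y' y' := by linarith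
  have h2 : 2 * (B x y' / (1 - B y' y')) * B x y' + B y' y' * (B x y' / (1 - B y' y')) ^ 2 =
      (B x y' / (1 - B y' y')) ^ 2 * (2 - B y' y') := by
    field_simp
    ring
  rw [h2] at h1
  have : 0 < (B x y' / (1 - B y' y')) ^ 2 := by positivity
  nlinarith

end LinearMap.BilinForm.IsLorentzian

/-! ### Stable quadratic polynomials are Lorentzian. -/

namespace IsStable

open MvPolynomial

variable {σ : Type*} [Fintype σ] {K : Set (σ → ℝ)} {n : ℕ} {p : MvPolynomial σ ℝ}

/-- When x is orthogonal to e, p(x + ice) = (B(x, x) - c² B(e, e))/2 with B the Hessian. A positive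
B(x, x) would make this vanish for some real c > 0. -/
lemma hessForm_isLorentzian (hK : IsOpenConvexCone K) (h : IsStable K 2 p) {e : σ → ℝ}
    (he : e ∈ K) : (hessForm p).IsLorentzian e := by
  have hpos : 0 < hessForm p e e := by
    have := h.pos e he
    rw [h.homog.eval_eq_hessForm] at this
    linarith
  refine ⟨isSymm_hessForm p, hpos, fun x hx => ?_⟩
  by_contra! hxx
  set c := √(hessForm p x x / hessForm p e e)
  have hc : 0 < c := Real.sqrt_pos.mpr (div_pos hxx hpos)
  have hc2 : c ^ 2 * hessForm p e e = hessForm p x x := by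
    rw [Real.sq_sqrt (div_pos hxx hpos).le, div_mul_cancel₀ _ hpos.ne']
  refine h.ne_zero x _ (hK.smul_mem he hc) ?_
  have := h.homog.aeval_add_smul x e (Complex.I * c)
  rw [(isSymm_hessForm p).eq e x |>.symm.trans hx |> fun h : hessForm p x e = 0 => h] at this
  simp only [Pi.smul_apply, smul_eq_mul, Complex.ofReal_mul, ← mul_assoc, this, mul_pow,
    Complex.I_sq, ← hc2]
  push_cast
  ring

protected lemma iterD (hK : IsOpenConvexCone K) (L : List (σ → ℝ)) (hL : ∀ a ∈ L, a ∈ K)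
    (h : IsStable K (n + L.length) p) : IsStable K n (MvPolynomial.iterD L p) := by
  induction L generalizing n with
  | nil => exact h
  | cons a L ih =>
    rw [List.forall_mem_cons] at hL
    refine IsStable.dirD hK (ih hL.2 ?_) hL.1
    rwa [List.length_cons, add_comm L.length, ← add_assoc] at h

end IsStable

/-! ### Testing a polynomial by derivatives along the cone. -/

namespace MvPolynomial

variable {σ : Type*} [Fintype σ] {K : Set (σ → ℝ)} {n : ℕ} {p : MvPolynomial σ ℝ}

lemma IsHomogeneous.iterD (L : List (σ → ℝ)) (h : p.IsHomogeneous (n + L.length)) :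
    (MvPolynomial.iterD L p).IsHomogeneous n := by
  induction L generalizing n with
  | nil => exact h
  | cons a L ih =>
    have := ih (n := n + 1) (by rwa [List.length_cons, add_comm L.length, ← add_assoc] at h)
    exact this.dirD a

/-- The cone spans, so every directional derivative vanishes; Euler's identity then kills p. -/
lemma IsHomogeneous.eq_zero_of_dirD (hK : IsOpenConvexCone K) (hp : p.IsHomogeneous (n + 1))
    (h : ∀ b ∈ K, MvPolynomial.dirD b p = 0) : p = 0 := by
  have hφ := hK.eq_zero_of_forall_mem (dirDLin p) h
  refine MvPolynomial.funext fun x => ?_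
  have h1 := hp.eval_dirD_self x
  rw [show MvPolynomial.dirD x p = 0 from DFunLike.congr_fun hφ x, map_zero, zero_eq_mul] at h1
  simpa using h1.resolve_left (by positivity)

lemma IsHomogeneous.eq_zero_of_iterD (hK : IsOpenConvexCone K) {m : ℕ}
    (hp : p.IsHomogeneous (n + 1 + m))
    (h : ∀ L : List (σ → ℝ), L.length = m → (∀ a ∈ L, a ∈ K) → MvPolynomial.iterD L p = 0) :
    p = 0 := by
  induction m generalizing p with
  | zero => exact h [] rfl (by simp)
  | succ m ih =>
    refine IsHomogeneous.eq_zero_of_dirD (n := n + 1 + m) hK hp fun b hb => ?_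
    refine ih (hp.dirD b) fun L hL hLK => ?_
    rw [iterD_dirD]
    exact h (b :: L) (by simp [hL]) (by simpa using ⟨hb, hLK⟩)

end MvPolynomial

/-! ### Cancelling cone directions. -/

namespace IsStable

open MvPolynomial

variable {σ : Type*} [Fintype σ] {K : Set (σ → ℝ)} {n : ℕ} {p : MvPolynomial σ ℝ}

/-- For every b in the cone the Hessian of D_b p is Lorentzian relative to the same a, and x is
orthogonal to a for it. So the linear function φ(b) = D_x D_x D_b p is nonpositive on the cone. It
vanishes at the interior point a, hence on the whole cone, and the equality case puts x in the
radical of each of these Hessians. -/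
lemma dirD_eq_zero_of_cubic (hK : IsOpenConvexCone K) (h : IsStable K 3 p) {a x : σ → ℝ}
    (ha : a ∈ K) (hx : MvPolynomial.dirD a (MvPolynomial.dirD x p) = 0) :
    MvPolynomial.dirD x p = 0 := by
  have hB (b : σ → ℝ) (hb : b ∈ K) : (hessForm (MvPolynomial.dirD b p)).IsLorentzian a :=
    (h.dirD hK hb).hessForm_isLorentzian hK ha
  have hax (b : σ → ℝ) : hessForm (MvPolynomial.dirD b p) a x = 0 := by
    rw [hessForm_apply, dirD_comm x b, dirD_comm a b, hx]; simp
  have hle (b : σ → ℝ) (hb : b ∈ K) : hessForm (MvPolynomial.dirD b p) x x ≤ 0 :=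
    (hB b hb).nonpos x (hax b)
  obtain ⟨φ, hφdef⟩ : ∃ φ : (σ → ℝ) →ₗ[ℝ] ℝ,
      ∀ b, φ b = hessForm (MvPolynomial.dirD b p) x x :=
    ⟨(aeval 0).toLinearMap ∘ₗ (MvPolynomial.dirD x).toLinearMap ∘ₗ
      (MvPolynomial.dirD x).toLinearMap ∘ₗ dirDLin p, fun b => by
        simp [dirDLin_apply, aeval_eq_eval]⟩
  have hφa : φ a = 0 := by
    rw [hφdef, hessForm_apply, dirD_comm x a, hx]; simp
  have hφ (b : σ → ℝ) (hb : b ∈ K) : φ b = 0 := by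
    refine le_antisymm ((hφdef b).trans_le (hle b hb)) ?_
    -- Since a - εb is in the cone and φ(a) = 0, also -εφ(b) ≤ 0.
    obtain ⟨ε, hε, hm⟩ := hK.exists_add_smul_mem ha (-b)
    have h1 := hle _ hm
    rw [← hφdef] at h1
    simp only [map_add, hφa, zero_add, map_smul, map_neg, smul_eq_mul] at h1
    nlinarith
  have hdx : (MvPolynomial.dirD x p).IsHomogeneous 2 := h.homog.dirD x
  refine hdx.eq_zero_of_dirD (n := 1) hK fun b hb => ?_
  refine IsHomogeneous.eq_zero_of_dirD (n := 0) hK (hdx.dirD b) fun c _ => ?_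
  rw [((hdx.dirD b).dirD c).eq_C 0]
  have := (hB b hb).apply_eq_zero (hax b) ((hφdef b).symm.trans (hφ b hb)) c
  rw [hessForm_apply, dirD_comm x c, dirD_comm x b] at this
  rw [this, C_0]

/-- D_x p has degree n + 2 and is determined by its n-fold derivatives along the cone; each of them
is D_x of a stable cubic. -/
lemma dirD_eq_zero_of_dirD (hK : IsOpenConvexCone K) (h : IsStable K (n + 3) p) {a x : σ → ℝ}
    (ha : a ∈ K) (hx : MvPolynomial.dirD a (MvPolynomial.dirD x p) = 0) :
    MvPolynomial.dirD x p = 0 := by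
  refine IsHomogeneous.eq_zero_of_iterD (n := 1) (m := n) hK
    (by convert h.homog.dirD x using 1; omega) fun L hL hLK => ?_
  rw [iterD_dirD]
  refine dirD_eq_zero_of_cubic hK (IsStable.iterD hK L hLK (by rwa [hL, add_comm 3])) ha ?_
  rw [← iterD_dirD, ← iterD_dirD, hx]
  clear hL hLK
  induction L with
  | nil => rfl
  | cons b L ih => rw [iterD_cons, ih, map_zero]

/-- A direction that some iterated derivative to degree two does not see is a direction of
translation invariance. -/
lemma dirD_eq_zero_of_iterD (hK : IsOpenConvexCone K) (L : List (σ → ℝ)) (hL : ∀ a ∈ L, a ∈ K)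
    (h : IsStable K (2 + L.length) p) {x : σ → ℝ}
    (hx : MvPolynomial.dirD x (MvPolynomial.iterD L p) = 0) : MvPolynomial.dirD x p = 0 := by
  induction L generalizing p with
  | nil => exact hx
  | cons a L ih =>
    rw [List.forall_mem_cons] at hL
    have h' : IsStable K (L.length + 3) p := by
      convert h using 1; simp only [List.length_cons]; omega
    refine h'.dirD_eq_zero_of_dirD hK hL.1 ?_
    rw [dirD_comm]
    -- The induction hypothesis is used for D_a p, one degree lower, with the remaining directions.
    refine ih hL.2 (by convert h'.dirD hK hL.1 using 1; omega) ?_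
    rwa [iterD_dirD]

end IsStable

/-! ### Multilinear coefficients; homogeneity from a power. -/

namespace MvPolynomial

variable {σ : Type*}

/-- No factorials appear: the indices are distinct and absent from m, so each derivative multiplies
the coefficient by 1. -/
lemma coeff_foldr_pderiv {n : ℕ} (l : List (Fin n)) (hl : l.Nodup) (m : Fin n →₀ ℕ)
    (hm : ∀ i ∈ l, m i = 0) (Q : MvPolynomial (Fin n) ℝ) :
    coeff m (l.foldr (fun i q => pderiv i q) Q) =
      coeff (m + (l.map fun i => Finsupp.single i 1).sum) Q := by
  induction l generalizing m with
  | nil => simp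
  | cons i l ih =>
    rw [List.nodup_cons] at hl
    rw [List.forall_mem_cons] at hm
    rw [List.foldr_cons, coeff_pderiv, hm.1, ih hl.2]
    · simp [add_assoc]
    · intro j hj
      have : i ≠ j := fun h => hl.1 (h ▸ hj)
      simp [hm.2 j hj, this]

lemma coeff_sum_single_eq {n : ℕ} (Q : MvPolynomial (Fin n) ℝ) :
    coeff (∑ i, Finsupp.single i 1) Q =
      eval 0 ((List.finRange n).foldr (fun i q => pderiv i q) Q) := by
  have h := coeff_foldr_pderiv (List.finRange n) (List.nodup_finRange n) 0 (by simp) Q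
  rw [zero_add, ← List.ofFn_eq_map, List.sum_ofFn] at h
  rw [← h]
  rw [eval_zero, constantCoeff_eq]

/-- The multilinear coefficient of a polynomial along linear combinations is an iterated
directional derivative. -/
lemma coeff_sum_single_of_eval_eq {n : ℕ} [Finite σ] (p : MvPolynomial σ ℝ) (a : Fin n → σ → ℝ)
    (Q : MvPolynomial (Fin n) ℝ) (hQ : ∀ l : Fin n → ℝ, eval l Q = eval (∑ i, l i • a i) p) :
    coeff (∑ i, Finsupp.single i 1) Q = eval 0 (iterD (List.ofFn a) p) := by
  -- The generic combination of the vectors a j; Q is p composed with it, and ∂/∂X_j becomes the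
  -- derivative along a j.
  set φ : σ → MvPolynomial (Fin n) ℝ := fun k => ∑ j, C (a j k) * X j
  have hφ (j : Fin n) (k : σ) : pderiv j (φ k) = algebraMap ℝ _ (a j k) := by
    simp [φ, pderiv_X, Pi.single_apply, algebraMap_eq]
  have hev (l : Fin n → ℝ) (r : MvPolynomial σ ℝ) :
      eval l (aeval φ r) = eval (∑ i, l i • a i) r := by
    have : (aeval l : MvPolynomial (Fin n) ℝ →ₐ[ℝ] ℝ).comp (aeval φ) =
        aeval (∑ i, l i • a i) := algHom_ext fun k => by
      simp [φ, Finset.sum_apply, mul_comm, aeval_eq_eval]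
    simpa [aeval_eq_eval] using DFunLike.congr_fun this r
  have hQφ : Q = aeval φ p := MvPolynomial.funext fun l => by rw [hQ, hev]
  have hfold (l : List (Fin n)) :
      l.foldr (fun i q => pderiv i q) (aeval φ p) = aeval φ (iterD (l.map a) p) := by
    induction l with
    | nil => rfl
    | cons i l ih => rw [List.foldr_cons, ih, derivation_aeval _ φ (a i) (hφ i), List.map_cons,
        iterD_cons]
  rw [coeff_sum_single_eq, hQφ, hfold, hev, List.ofFn_eq_map]
  simp

/-- On a ray, g(t) = p(tx) satisfies gᵏ = c t^(kn). If c ≠ 0, unique factorization makes g a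
monomial, of degree n; if c = 0, g is zero. The coefficients of g are the values at x of the
homogeneous components. The Moore determinant needs this form because it is given through its fourth
power. -/
lemma isHomogeneous_of_eval_smul_pow {n k : ℕ} (hk : 0 < k) {p : MvPolynomial σ ℝ}
    (h : ∀ (t : ℝ) (x : σ → ℝ), eval (t • x) p ^ k = t ^ (k * n) * eval x p ^ k) :
    p.IsHomogeneous n := by
  suffices hc : ∀ i ≠ n, homogeneousComponent i p = 0 by
    rw [← sum_homogeneousComponent p]
    refine IsHomogeneous.sum _ _ _ fun i _ => ?_
    by_cases hi : i = n
    · exact hi ▸ homogeneousComponent_isHomogeneous i p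
    · rw [hc i hi]; exact isHomogeneous_zero _ _ _
  intro i hi
  refine MvPolynomial.funext fun x => ?_
  rw [map_zero]
  set g : Polynomial ℝ := ∑ i ∈ Finset.range (p.totalDegree + 1),
    Polynomial.C (eval x (homogeneousComponent i p)) * Polynomial.X ^ i with hg
  have hgcoeff : g.coeff i = eval x (homogeneousComponent i p) := by
    simp only [hg, Polynomial.finsetSum_coeff, Polynomial.coeff_C_mul_X_pow]
    rw [Finset.sum_ite_eq]
    split_ifs with hmem
    · rfl
    · rw [homogeneousComponent_eq_zero _ _ (by simpa using hmem), map_zero]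
  have hgeval (t : ℝ) : g.eval t = eval (t • x) p := by
    conv_rhs => rw [← sum_homogeneousComponent p]
    simp only [hg, Polynomial.eval_finsetSum, map_sum]
    refine Finset.sum_congr rfl fun j _ => ?_
    have := (homogeneousComponent_isHomogeneous j p).aeval_mul t x
    rw [aeval_eq_eval, aeval_eq_eval] at this
    rw [Polynomial.eval_mul, Polynomial.eval_C, Polynomial.eval_pow, Polynomial.eval_X, mul_comm]
    exact this.symm
  have hpow : g ^ k = Polynomial.C (eval x p ^ k) * Polynomial.X ^ (k * n) :=
    Polynomial.funext fun t => by
      rw [Polynomial.eval_pow, hgeval, h]; simp [mul_comm]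
  rw [← hgcoeff]
  by_cases hx : eval x p = 0
  · rw [hx, zero_pow hk.ne', Polynomial.C_0, zero_mul] at hpow
    rw [eq_zero_of_pow_eq_zero hpow, Polynomial.coeff_zero]
  have hunit : IsUnit (Polynomial.C (eval x p ^ k)) :=
    Polynomial.isUnit_C.mpr (pow_ne_zero _ hx).isUnit
  have hdvd : g ∣ Polynomial.X ^ (k * n) :=
    ((dvd_pow_self g hk.ne').trans hpow.dvd).trans (hunit.mul_left_dvd.mpr dvd_rfl)
  obtain ⟨j, -, u, hu⟩ := (dvd_prime_pow Polynomial.prime_X _).mp hdvd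
  have hg0 : g ≠ 0 := by rintro h; simp [h] at hu; exact pow_ne_zero _ Polynomial.X_ne_zero hu.symm
  obtain ⟨c, hc, hcu⟩ := Polynomial.isUnit_iff.mp u⁻¹.isUnit
  have hgj : g = Polynomial.C c * Polynomial.X ^ j := by
    rw [hcu, ← hu]; rw [mul_comm, mul_assoc]; simp
  have hdeg := congrArg Polynomial.natDegree hpow
  rw [Polynomial.natDegree_pow, Polynomial.natDegree_C_mul_X_pow _ _ (pow_ne_zero _ hx), hgj,
    Polynomial.natDegree_C_mul_X_pow _ _ hc.ne_zero] at hdeg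
  rw [hgj, Polynomial.coeff_C_mul_X_pow, if_neg]
  exact fun hij => hi (hij.trans (Nat.eq_of_mul_eq_mul_left hk hdeg))

end MvPolynomial

/-! ### Signature of a Lorentzian form. -/

namespace LinearMap.BilinForm.IsLorentzian

variable {V : Type*} [AddCommGroup V] [Module ℝ V] {B : LinearMap.BilinForm ℝ V} {e : V}

/-- The form is nonpositive on the kernel of B e, of codimension at most one, and positive definite
on the line through e. -/
lemma sigPos_eq_one [FiniteDimensional ℝ V] (h : B.IsLorentzian e) :
    sigPos B.toQuadraticMap = 1 := by
  apply le_antisymm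
  · have hker : ∀ x ∈ LinearMap.ker (B e), B.toQuadraticMap x ≤ 0 := fun x hx =>
      h.nonpos x hx
    have h1 := QuadraticForm.sigPos_add_finrank_le_of_nonpos hker
    have h2 := (B e).finrank_range_add_finrank_ker
    have h3 : Module.finrank ℝ (LinearMap.range (B e)) ≤ 1 := by
      simpa using (LinearMap.range (B e)).finrank_le
    omega
  · have he : e ≠ 0 := by rintro rfl; simpa using h.pos
    rw [← finrank_span_singleton (K := ℝ) he]
    refine le_sigPos_of_posDef _ fun x hx => ?_
    obtain ⟨c, hc⟩ := Submodule.mem_span_singleton.mp x.2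
    have hc0 : c ≠ 0 := by
      rintro rfl
      exact hx (Subtype.ext (by simpa using hc.symm))
    have : 0 < c * (c * B e e) := by
      have := h.pos
      rw [← mul_assoc]
      exact mul_pos (mul_self_pos.mpr hc0) this
    simpa [← hc] using this

lemma sigNeg_add_one_eq_finrank [FiniteDimensional ℝ V] (h : B.IsLorentzian e)
    (hB : B.Nondegenerate) : sigNeg B.toQuadraticMap + 1 = Module.finrank ℝ V := by
  have h1 := QuadraticForm.sigPos_add_sigNeg_add_radical (Q := B.toQuadraticMap)
  have hrad : B.toQuadraticMap.radical = ⊥ := by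
    rw [QuadraticMap.radical_eq_ker_associated, eq_bot_iff]
    intro x hx
    rw [LinearMap.mem_ker, QuadraticMap.associated_left_inverse ℝ h.isSymm.eq] at hx
    exact hB.1 x fun y => by rw [hx]; rfl
  rw [h.sigPos_eq_one, hrad, finrank_bot] at h1
  omega

end LinearMap.BilinForm.IsLorentzian

/-! ### Real positive definite matrices. -/

namespace Matrix

variable {ι : Type*} [Fintype ι]

/-- Positive definiteness is an open condition along lines. -/
lemma PosDef.exists_add_smul_pos {S : Matrix ι ι ℝ} (hS : S.PosDef) (T : Matrix ι ι ℝ) :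
    ∃ ε : ℝ, 0 < ε ∧ ∀ u : ι → ℝ, u ≠ 0 → 0 < u ⬝ᵥ (S + ε • T) *ᵥ u := by
  have hpos := (posDef_iff_dotProduct_mulVec.mp hS).2
  have hcont (M : Matrix ι ι ℝ) : Continuous fun u : ι → ℝ => u ⬝ᵥ M *ᵥ u := by fun_prop
  have hcomp : IsCompact (Metric.sphere (0 : ι → ℝ) 1) := isCompact_sphere 0 1
  rcases (Metric.sphere (0 : ι → ℝ) 1).eq_empty_or_nonempty with hemp | hne
  · refine ⟨1, one_pos, fun u hu => ?_⟩
    have : ‖u‖⁻¹ • u ∈ Metric.sphere (0 : ι → ℝ) 1 := by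
      rw [mem_sphere_zero_iff_norm, norm_smul, norm_inv, norm_norm,
        inv_mul_cancel₀ (norm_ne_zero_iff.mpr hu)]
    simp [hemp] at this
  obtain ⟨u₀, hu₀, hmin⟩ := hcomp.exists_isMinOn hne (hcont S).continuousOn
  have hm : 0 < u₀ ⬝ᵥ S *ᵥ u₀ := by
    have := @hpos u₀ (by rintro rfl; simp at hu₀)
    simpa using this
  set m := u₀ ⬝ᵥ S *ᵥ u₀
  obtain ⟨C, hC⟩ := hcomp.exists_bound_of_continuousOn (hcont T).continuousOn
  have hC0 : 0 ≤ C := (norm_nonneg _).trans (hC u₀ hu₀)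
  -- On the unit sphere the form of S is at least m and that of T at least -C, so the sum is at
  -- least m - mC/(C + 1) = m/(C + 1).
  refine ⟨m / (C + 1), by positivity, fun u hu => ?_⟩
  have hn : 0 < ‖u‖ := norm_pos_iff.mpr hu
  set v := ‖u‖⁻¹ • u
  have hv : v ∈ Metric.sphere (0 : ι → ℝ) 1 := by
    rw [mem_sphere_zero_iff_norm, norm_smul, norm_inv, norm_norm,
      inv_mul_cancel₀ (norm_ne_zero_iff.mpr hu)]
  have huv : u = ‖u‖ • v := by rw [smul_smul, mul_inv_cancel₀ hn.ne', one_smul]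
  have h1 : m ≤ v ⬝ᵥ S *ᵥ v := hmin hv
  have h2 := (abs_le.mp (hC v hv)).1
  have h3 : 0 < v ⬝ᵥ (S + (m / (C + 1)) • T) *ᵥ v := by
    rw [add_mulVec, smul_mulVec, dotProduct_add, dotProduct_smul, smul_eq_mul]
    have h4 : m / (C + 1) * -C ≤ m / (C + 1) * v ⬝ᵥ T *ᵥ v :=
      mul_le_mul_of_nonneg_left h2 (by positivity)
    have h5 : m + m / (C + 1) * -C = m / (C + 1) := by field_simp; ring
    have : 0 < m / (C + 1) := by positivity
    linarith
  rw [huv, mulVec_smul, dotProduct_smul, smul_dotProduct, smul_eq_mul, smul_eq_mul]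
  positivity

/-- A complex combination `S + iT` of real symmetric matrices is invertible if `T` is positive
definite. -/
lemma PosDef.det_add_I_smul_ne_zero [DecidableEq ι] {S T : Matrix ι ι ℝ} (hS : S.IsHermitian)
    (hT : T.PosDef) :
    (S.map Complex.ofReal + Complex.I • T.map Complex.ofReal).det ≠ 0 := by
  intro hdet
  obtain ⟨v, hv, hv0⟩ := exists_mulVec_eq_zero_iff.mpr hdet
  -- For v = a + ib the cross terms cancel by symmetry. Pairing the kernel equation with v and
  -- taking imaginary parts then leaves aᵀTa + bᵀTb = 0.
  have key (M : Matrix ι ι ℝ) (hM : M.IsHermitian) :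
      star v ⬝ᵥ M.map Complex.ofReal *ᵥ v =
        (((fun i => (v i).re) ⬝ᵥ M *ᵥ (fun i => (v i).re) +
          (fun i => (v i).im) ⬝ᵥ M *ᵥ (fun i => (v i).im) : ℝ) : ℂ) := by
    apply Complex.ext
    · simp only [dotProduct, mulVec, Pi.star_apply, map_apply, Complex.re_sum, Complex.ofReal_re,
        ← Finset.sum_add_distrib, Finset.mul_sum]
      refine Finset.sum_congr rfl fun i _ => Finset.sum_congr rfl fun j _ => ?_
      simp
    · have hH : (M.map Complex.ofReal).IsHermitian := by
        ext i j
        have := hM.apply i j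
        simp only [star_trivial] at this
        simp [this]
      rw [Complex.ofReal_im]
      exact hH.im_star_dotProduct_mulVec_self v
  have h0 := congrArg (fun w => star v ⬝ᵥ w) hv0
  simp only [add_mulVec, smul_mulVec, dotProduct_add, dotProduct_smul, dotProduct_zero,
    key S hS, key T hT.1, smul_eq_mul] at h0
  have him := congrArg Complex.im h0
  simp only [Complex.add_im, Complex.ofReal_im, Complex.I_mul_im, Complex.ofReal_re, zero_add,
    Complex.zero_im] at him
  have hpos := (posDef_iff_dotProduct_mulVec.mp hT).2
  have hnn (u : ι → ℝ) : 0 ≤ u ⬝ᵥ T *ᵥ u := by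
    by_cases hu : u = 0
    · simp [hu]
    · simpa using (hpos hu).le
  have hzero (u : ι → ℝ) (h : u ⬝ᵥ T *ᵥ u = 0) : u = 0 := by
    by_contra hu
    have := hpos hu
    rw [star_trivial, h] at this
    exact lt_irrefl _ this
  have h1 := hzero _ (le_antisymm (by linarith [hnn fun i => (v i).im]) (hnn fun i => (v i).re))
  have h2 := hzero _ (le_antisymm (by linarith [hnn fun i => (v i).re]) (hnn fun i => (v i).im))
  exact hv (funext fun i => Complex.ext (congrFun h1 i) (congrFun h2 i))

end Matrix

/-! ### The cone of positive definite hyperhermitian matrices. -/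

namespace QuatMoore

variable {n : ℕ}

lemma sum_re_star_quatUnit_mul (x y : ℍ[ℝ]) :
    ∑ a, (star (quatUnit a) * x).re * (star (quatUnit a) * y).re = (star x * y).re := by
  simp only [re_star_quatUnit_mul, Fin.sum_univ_four]
  simp [Quaternion.re_mul]

lemma re_hform_self (A : HyperHerm n) (x : Fin n → ℍ[ℝ]) :
    (hform A x x).re = (realBasis n).repr x ⬝ᵥ (realMatrix A).mulVec ((realBasis n).repr x) := by
  rw [← toMatrix_rightLin, LinearMap.toMatrix_mulVec_repr]
  simp only [dotProduct, Fintype.sum_prod_type, realBasis_repr, sum_re_star_quatUnit_mul]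
  have hre {ι : Type} [Fintype ι] (f : ι → ℍ[ℝ]) : (∑ i, f i).re = ∑ i, (f i).re :=
    map_sum (QuaternionAlgebra.reₗ (-1 : ℝ) 0 (-1)) f _
  rw [hform, hre]
  refine Finset.sum_congr rfl fun i _ => ?_
  simp [rightLin, Matrix.mulVec, dotProduct, Finset.mul_sum, mul_assoc]

lemma isPosDef_iff_posDef (A : HyperHerm n) : IsPosDef A ↔ (realMatrix A).PosDef := by
  rw [Matrix.posDef_iff_dotProduct_mulVec, and_iff_right (realMatrix_isHermitian A)]
  refine ⟨fun h u hu => ?_, fun h x hx => ?_⟩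
  · have := h ((realBasis n).equivFun.symm u) ((LinearEquiv.map_ne_zero_iff _).mpr hu)
    rw [re_hform_self, ← Module.Basis.equivFun_apply, LinearEquiv.apply_symm_apply] at this
    simpa using this
  · rw [re_hform_self, ← Module.Basis.equivFun_apply]
    simpa using h (x := (realBasis n).equivFun x) (by simpa using hx)

/-- The map `A ↦ realMatrix A` as a linear map. -/
noncomputable def realMatrixLin (n : ℕ) :
    HyperHerm n →ₗ[ℝ] Matrix (Fin n × Fin 4) (Fin n × Fin 4) ℝ where
  toFun := realMatrix
  map_add' A B := by
    ext p q
    simp [realMatrix_apply, mul_add, add_mul]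
  map_smul' c A := by
    ext p q
    simp only [realMatrix_apply, Submodule.coe_smul, Matrix.smul_apply, mul_smul_comm,
      smul_mul_assoc, Quaternion.re_smul, RingHom.id_apply]

lemma realMatrixLin_apply (A : HyperHerm n) : realMatrixLin n A = realMatrix A := rfl

lemma realMatrix_injective : Function.Injective (realMatrixLin n) := by
  rw [← LinearMap.ker_eq_bot, LinearMap.ker_eq_bot']
  intro A hA
  have hA' : realMatrix A = 0 := hA
  have h (i j : Fin n) (a : Fin 4) : ![(A.1 i j).re, (A.1 i j).imI, (A.1 i j).imJ, (A.1 i j).imK] a = 0 := by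
    -- The columns belonging to the unit 1 contain the four real coordinates of each entry.
    have := congrFun (congrFun hA' (i, a)) (j, 0)
    rw [realMatrix_apply, show quatUnit 0 = 1 from rfl, mul_one, re_star_quatUnit_mul] at this
    exact this
  refine Subtype.ext (Matrix.ext fun i j => ?_)
  exact Quaternion.ext _ _ (h i j 0) (h i j 1) (h i j 2) (h i j 3)

lemma isPosDef_id (n : ℕ) : IsPosDef (HyperHerm.id n) := by
  rw [isPosDef_iff_posDef, realMatrix_id]
  exact Matrix.PosDef.one

/-- The cone of positive definite hyperhermitian matrices. -/
lemma isOpenConvexCone_isPosDef (n : ℕ) : IsOpenConvexCone {A : HyperHerm n | IsPosDef A} where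
  nonempty := ⟨_, isPosDef_id n⟩
  smul_mem {A} hA t ht := by
    simp only [Set.mem_ofPred_eq, isPosDef_iff_posDef, ← realMatrixLin_apply, map_smul] at hA ⊢
    exact hA.smul ht
  add_mem {A B} hA hB := by
    simp only [Set.mem_ofPred_eq, isPosDef_iff_posDef, ← realMatrixLin_apply, map_add] at hA hB ⊢
    exact hA.add hB
  exists_add_smul_mem {A} hA X := by
    have hA' := (isPosDef_iff_posDef A).mp hA
    obtain ⟨ε, hε, h⟩ := hA'.exists_add_smul_pos (realMatrix X)
    refine ⟨ε, hε, (isPosDef_iff_posDef _).mpr ?_⟩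
    rw [Matrix.posDef_iff_dotProduct_mulVec]
    refine ⟨realMatrix_isHermitian _, fun u hu => ?_⟩
    rw [← realMatrixLin_apply, map_add, map_smul]
    simpa [realMatrixLin_apply] using h u hu

lemma exists_isRoot_charpoly_of_ne_zero {A : HyperHerm n} (hA : A ≠ 0) :
    ∃ μ : ℝ, μ ≠ 0 ∧ (realMatrix A).charpoly.IsRoot μ := by
  have hH := realMatrix_isHermitian A
  have hne : hH.eigenvalues ≠ 0 := fun h =>
    hA (realMatrix_injective ((hH.eigenvalues_eq_zero_iff.mp h).trans (map_zero _).symm))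
  obtain ⟨p, hp⟩ := Function.ne_iff.mp hne
  exact ⟨_, hp, Matrix.mem_spectrum_iff_isRoot_charpoly.mp (hH.eigenvalues_mem_spectrum_real p)⟩

end QuatMoore

/-! ### Stability of the Moore determinant and mixed discriminants. -/

namespace QuatMoore

open MvPolynomial

variable {n : ℕ}

/-- Coordinates on the space of hyperhermitian matrices. -/
noncomputable def coords (n : ℕ) :
    HyperHerm n ≃ₗ[ℝ] (Fin (Module.finrank ℝ (HyperHerm n)) → ℝ) :=
  (Module.finBasis ℝ (HyperHerm n)).equivFun

/-- The Moore determinant as a polynomial in coordinates. -/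
noncomputable def moorePoly (n : ℕ) : MvPolynomial (Fin (Module.finrank ℝ (HyperHerm n))) ℝ :=
  (polyFun_comb (isMooreDet_mooreDet n).poly (Module.finBasis ℝ (HyperHerm n))).choose

lemma eval_moorePoly (l : Fin (Module.finrank ℝ (HyperHerm n)) → ℝ) :
    eval l (moorePoly n) = mooreDet ((coords n).symm l) := by
  rw [coords, Module.Basis.equivFun_symm_apply]
  exact (polyFun_comb (isMooreDet_mooreDet n).poly (Module.finBasis ℝ _)).choose_spec.1 l

lemma det_realMatrix (A : HyperHerm n) : (realMatrix A).det = mooreDet A ^ 4 :=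
  (isMooreDet_mooreDet n).pow_four A

lemma mooreDet_id : mooreDet (HyperHerm.id n) = 1 := (isMooreDet_mooreDet n).id_eq_one

/-- The positive definite cone in coordinates. -/
def posCone (n : ℕ) : Set (Fin (Module.finrank ℝ (HyperHerm n)) → ℝ) :=
  {v | IsPosDef ((coords n).symm v)}

lemma coords_mem_posCone {A : HyperHerm n} : coords n A ∈ posCone n ↔ IsPosDef A := by
  simp [posCone]

lemma isOpenConvexCone_posCone (n : ℕ) : IsOpenConvexCone (posCone n) where
  nonempty := ⟨_, coords_mem_posCone.mpr (isPosDef_id n)⟩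
  smul_mem {y} hy t ht := by
    simpa [posCone] using (isOpenConvexCone_isPosDef n).smul_mem hy ht
  add_mem {y a} hy ha := by
    simpa [posCone] using (isOpenConvexCone_isPosDef n).add_mem hy ha
  exists_add_smul_mem {a} ha x := by
    simpa [posCone] using (isOpenConvexCone_isPosDef n).exists_add_smul_mem ha ((coords n).symm x)

lemma isHomogeneous_moorePoly (n : ℕ) : (moorePoly n).IsHomogeneous n := by
  refine isHomogeneous_of_eval_smul_pow (k := 4) (by norm_num) fun t x => ?_
  rw [eval_moorePoly, eval_moorePoly, ← det_realMatrix, ← det_realMatrix, map_smul,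
    ← realMatrixLin_apply, map_smul, Matrix.det_smul, realMatrixLin_apply, Fintype.card_prod,
    Fintype.card_fin, Fintype.card_fin, mul_comm 4 n]

/-- The fourth power of the complexified Moore polynomial is the determinant of the complexified
real matrix. -/
lemma aeval_moorePoly_pow_four (x y : Fin (Module.finrank ℝ (HyperHerm n)) → ℝ) :
    aeval (fun i => (x i : ℂ) + Complex.I * (y i : ℂ)) (moorePoly n) ^ 4 =
      ((realMatrix ((coords n).symm x)).map Complex.ofReal +
        Complex.I • (realMatrix ((coords n).symm y)).map Complex.ofReal).det := by
  set b := Module.finBasis ℝ (HyperHerm n)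
  -- The generic real matrix: the fourth-power relation becomes a polynomial identity, so complex
  -- values may be substituted.
  let M : Matrix (Fin n × Fin 4) (Fin n × Fin 4) (MvPolynomial _ ℝ) :=
    Matrix.of fun p q => ∑ i, C (realMatrix (b i) p q) * X i
  have hR (l : Fin (Module.finrank ℝ (HyperHerm n)) → ℝ) (p q : Fin n × Fin 4) :
      realMatrix ((coords n).symm l) p q = ∑ i, realMatrix (b i) p q * l i := by
    rw [coords, Module.Basis.equivFun_symm_apply, ← realMatrixLin_apply, map_sum,
      Matrix.sum_apply]
    simp [realMatrixLin_apply, mul_comm, b]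
  have hM : moorePoly n ^ 4 = M.det := by
    refine MvPolynomial.funext fun l => ?_
    rw [map_pow, eval_moorePoly, ← det_realMatrix, RingHom.map_det]
    congr 1
    ext p q
    simp [M, hR]
  rw [← map_pow, hM, AlgHom.map_det]
  congr 1
  ext p q
  simp only [AlgHom.mapMatrix_apply, Matrix.map_apply, M, Matrix.of_apply, map_sum, map_mul,
    aeval_X, Matrix.add_apply, Matrix.smul_apply, hR, smul_eq_mul, Complex.ofReal_sum,
    Complex.ofReal_mul, Finset.mul_sum, ← Finset.sum_add_distrib]
  refine Finset.sum_congr rfl fun i _ => ?_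
  rw [aeval_C]
  simp only [Complex.coe_algebraMap]
  ring

lemma isStable_moorePoly (n : ℕ) : IsStable (posCone n) n (moorePoly n) := by
  have hne (x y : Fin (Module.finrank ℝ (HyperHerm n)) → ℝ) (hy : y ∈ posCone n) :
      aeval (fun i => (x i : ℂ) + Complex.I * (y i : ℂ)) (moorePoly n) ≠ 0 := fun h => by
    have h4 := aeval_moorePoly_pow_four x y
    rw [h, zero_pow four_ne_zero] at h4
    exact ((isPosDef_iff_posDef _).mp hy).det_add_I_smul_ne_zero
      (realMatrix_isHermitian _) h4.symm
  refine ⟨isHomogeneous_moorePoly n, fun x y hy => hne x y hy, fun y hy => ?_⟩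
  refine IsStable.pos_of_ne_zero (isOpenConvexCone_posCone n)
    (fun y hy => IsStable.eval_ne_zero_of_forall_aeval_ne_zero (isHomogeneous_moorePoly n)
      (fun x y hy => hne x y hy) hy) (coords_mem_posCone.mpr (isPosDef_id n)) ?_ hy
  rw [eval_moorePoly, LinearEquiv.symm_apply_apply, mooreDet_id]
  exact one_pos

lemma mixedDisc_eq (A : Fin n → HyperHerm n) :
    mixedDisc A =
      eval 0 (iterD (List.ofFn fun i => coords n (A i)) (moorePoly n)) / n.factorial := by
  rw [mixedDisc, coeff_sum_single_of_eval_eq (moorePoly n) (fun i => coords n (A i))]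
  intro l
  rw [eval_pencilPoly, eval_moorePoly]
  simp

lemma mixedDisc_pos (A : Fin n → HyperHerm n) (hA : ∀ i, IsPosDef (A i)) : 0 < mixedDisc A := by
  rw [mixedDisc_eq]
  have hK := isOpenConvexCone_posCone n
  have h : IsStable (posCone n) 0
      (iterD (List.ofFn fun i => coords n (A i)) (moorePoly n)) := by
    refine IsStable.iterD hK _ (fun a ha => ?_) (by simpa using isStable_moorePoly n)
    obtain ⟨i, rfl⟩ := (List.mem_ofFn' _ _).mp ha
    exact coords_mem_posCone.mpr (hA i)
  obtain ⟨y, hy⟩ := hK.nonempty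
  have := h.pos y hy
  rw [h.homog.eq_C 0, eval_C] at this
  positivity

/-- Used for the limit A i + t Id as t → 0. The functional φ is arbitrary so that the induction can
absorb the outer derivatives into it. -/
lemma continuous_iterD_add_smul {σ : Type*} (p : MvPolynomial σ ℝ) (L : List (σ → ℝ))
    (e : σ → ℝ) (φ : MvPolynomial σ ℝ →ₗ[ℝ] ℝ) :
    Continuous fun t : ℝ => φ (iterD (L.map fun a => a + t • e) p) := by
  induction L generalizing φ with
  | nil => simpa using continuous_const
  | cons a L ih =>
    simp only [List.map_cons, iterD_cons, dirD_add, dirD_smul, map_add, map_smul, smul_eq_mul]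
    exact (ih (φ ∘ₗ (dirD a).toLinearMap)).add
      (continuous_id.mul (ih (φ ∘ₗ (dirD e).toLinearMap)))

lemma re_hform_add_smul (A E : HyperHerm n) (t : ℝ) (x : Fin n → ℍ[ℝ]) :
    (hform (A + t • E) x x).re = (hform A x x).re + t * (hform E x x).re := by
  simp only [re_hform_self, ← realMatrixLin_apply, map_add, map_smul, Matrix.add_mulVec,
    Matrix.smul_mulVec, dotProduct_add, dotProduct_smul, smul_eq_mul]

lemma mixedDisc_nonneg (A : Fin n → HyperHerm n) (hA : ∀ i, IsNonnegDef (A i)) :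
    0 ≤ mixedDisc A := by
  have hcont : Continuous fun t : ℝ => mixedDisc fun i => A i + t • HyperHerm.id n := by
    have h := (continuous_iterD_add_smul (moorePoly n) (List.ofFn fun i => coords n (A i))
      (coords n (HyperHerm.id n)) (aeval 0).toLinearMap).div_const (n.factorial : ℝ)
    refine h.congr fun t => ?_
    rw [mixedDisc_eq, List.map_ofFn]
    simp [Function.comp_def]
  have hpos (t : ℝ) (ht : 0 < t) : 0 ≤ mixedDisc fun i => A i + t • HyperHerm.id n := by
    refine (mixedDisc_pos _ fun i x hx => ?_).le
    rw [re_hform_add_smul]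
    exact add_pos_of_nonneg_of_pos (hA i x) (mul_pos ht (isPosDef_id n x hx))
  have hlim := (hcont.tendsto 0).mono_left (nhdsWithin_le_nhds (s := Set.Ioi 0))
  simp only [zero_smul, add_zero] at hlim
  exact ge_of_tendsto hlim (Filter.eventually_of_mem self_mem_nhdsWithin hpos)

/-- The Moore determinant has no directions of translation invariance. -/
lemma eq_zero_of_dirD_moorePoly {X : HyperHerm n} (h : dirD (coords n X) (moorePoly n) = 0) :
    X = 0 := by
  have hinv (Y : HyperHerm n) : mooreDet (Y - X) = mooreDet Y := by
    set f := line (fun i => (coords n Y i : ℂ)) (coords n X) (moorePoly n)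
    have hf : f.derivative = 0 := by rw [derivative_line, h, map_zero]
    obtain ⟨c, hc⟩ := Polynomial.natDegree_eq_zero.mp (Polynomial.derivative_eq_zero.mp hf)
    have h0 : f.eval 0 = f.eval (-1) := by rw [← hc, Polynomial.eval_C, Polynomial.eval_C]
    have h1 : (fun i => (coords n Y i : ℂ) + -1 * (coords n X i : ℂ)) =
        fun i => ((coords n (Y - X) i : ℝ) : ℂ) := by
      ext i
      simp [sub_eq_add_neg]
    rw [eval_line, eval_line, h1] at h0
    simp only [zero_mul, add_zero, aeval_ofReal, eval_moorePoly,
      LinearEquiv.symm_apply_apply] at h0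
    exact_mod_cast h0.symm
  by_contra hX
  obtain ⟨μ, hμ, hroot⟩ := exists_isRoot_charpoly_of_ne_zero hX
  -- At Y = μ Id, invariance makes the characteristic polynomial of the real matrix of X at μ a
  -- power of μ, which is non-zero although μ is a root.
  have hdet := congrArg (· ^ 4) (hinv (μ • HyperHerm.id n))
  simp only [← det_realMatrix, ← realMatrixLin_apply, map_sub, map_smul] at hdet
  rw [realMatrixLin_apply, realMatrixLin_apply, realMatrix_id, Matrix.det_smul, Matrix.det_one,
    mul_one] at hdet
  rw [Polynomial.IsRoot, Matrix.eval_charpoly, Matrix.scalar_apply, ← Matrix.smul_one_eq_diagonal,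
    hdet] at hroot
  exact pow_ne_zero _ hμ hroot

/-! ### The mixed discriminant as a bilinear form. -/

/-- The quadratic polynomial obtained from the Moore determinant by differentiating along all
but two of the arguments. -/
noncomputable def mixedQuad {m : ℕ} (A : Fin m → HyperHerm (m + 2)) :
    MvPolynomial (Fin (Module.finrank ℝ (HyperHerm (m + 2)))) ℝ :=
  iterD (List.ofFn fun i => coords (m + 2) (A i)) (moorePoly (m + 2))

/-- The mixed discriminant as a bilinear form in its first two arguments. -/
noncomputable def mixedForm {m : ℕ} (A : Fin m → HyperHerm (m + 2)) :
    LinearMap.BilinForm ℝ (HyperHerm (m + 2)) :=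
  ((m + 2).factorial : ℝ)⁻¹ • (hessForm (mixedQuad A)).compl₁₂
    (coords (m + 2)).toLinearMap (coords (m + 2)).toLinearMap

variable {m : ℕ} (A : Fin m → HyperHerm (m + 2))

lemma mixedForm_apply (X Y : HyperHerm (m + 2)) :
    mixedForm A X Y =
      ((m + 2).factorial : ℝ)⁻¹ * hessForm (mixedQuad A) (coords _ X) (coords _ Y) := rfl

lemma mixedForm_eq_mixedDisc (X Y : HyperHerm (m + 2)) :
    mixedForm A X Y = mixedDisc (Matrix.vecCons X (Matrix.vecCons Y A)) := by
  rw [mixedForm_apply, mixedDisc_eq, inv_mul_eq_div]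
  simp [List.ofFn_succ, mixedQuad]

variable {A}

lemma isStable_mixedQuad (hA : ∀ i, IsPosDef (A i)) :
    IsStable (posCone (m + 2)) 2 (mixedQuad A) := by
  refine IsStable.iterD (isOpenConvexCone_posCone _) _ (fun a ha => ?_) ?_
  · obtain ⟨i, rfl⟩ := (List.mem_ofFn' _ _).mp ha
    exact coords_mem_posCone.mpr (hA i)
  · simpa [add_comm] using isStable_moorePoly (m + 2)

lemma mixedForm_isLorentzian (hA : ∀ i, IsPosDef (A i)) :
    (mixedForm A).IsLorentzian (HyperHerm.id (m + 2)) := by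
  have h := (isStable_mixedQuad hA).hessForm_isLorentzian (isOpenConvexCone_posCone _)
    (coords_mem_posCone.mpr (isPosDef_id (m + 2)))
  have hc : 0 < ((m + 2).factorial : ℝ)⁻¹ := by positivity
  refine ⟨⟨fun X Y => ?_⟩, ?_, fun X hX => ?_⟩
  · simp only [mixedForm_apply]
    rw [← h.isSymm.eq (coords _ X) (coords _ Y)]
  · rw [mixedForm_apply]
    exact mul_pos hc h.pos
  · rw [mixedForm_apply] at hX ⊢
    exact mul_nonpos_of_nonneg_of_nonpos hc.le
      (h.nonpos _ ((mul_eq_zero.mp hX).resolve_left hc.ne'))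

lemma mixedForm_nondegenerate (hA : ∀ i, IsPosDef (A i)) : (mixedForm A).Nondegenerate := by
  have hK := isOpenConvexCone_posCone (m + 2)
  suffices hleft : ∀ X, (∀ Y, mixedForm A X Y = 0) → X = 0 from
    ⟨hleft, fun Y hY => hleft Y fun X =>
      ((mixedForm_isLorentzian hA).isSymm.eq Y X).trans (hY X)⟩
  intro X hX
  refine eq_zero_of_dirD_moorePoly (IsStable.dirD_eq_zero_of_iterD hK
    (List.ofFn fun i => coords (m + 2) (A i)) (fun a ha => ?_)
    (by simpa [add_comm] using isStable_moorePoly (m + 2)) ?_)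
  · obtain ⟨i, rfl⟩ := (List.mem_ofFn' _ _).mp ha
    exact coords_mem_posCone.mpr (hA i)
  have hq := (isStable_mixedQuad hA).homog
  -- D_X of the quadratic polynomial is linear; its derivative along b is a constant, namely (m +
  -- 2)! times the value of the form at X and b.
  refine IsHomogeneous.eq_zero_of_dirD (n := 0) hK (hq.dirD _) fun b _ => ?_
  change dirD b (dirD (coords (m + 2) X) (mixedQuad A)) = 0
  rw [((hq.dirD _).dirD b).eq_C 0, dirD_comm]
  have := hX ((coords (m + 2)).symm b)
  rw [mixedForm_apply, LinearEquiv.apply_symm_apply, mul_eq_zero] at this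
  have := this.resolve_left (by positivity)
  rw [hessForm_apply] at this
  rw [this, C_0]

end QuatMoore

theorem theorem1p1p15 :
    (∀ (n : ℕ) (A : Fin n → QuatMoore.HyperHerm n),
      (∀ i, QuatMoore.IsPosDef (A i)) → 0 < QuatMoore.mixedDisc A) ∧
    (∀ (n : ℕ) (A : Fin n → QuatMoore.HyperHerm n),
      (∀ i, QuatMoore.IsNonnegDef (A i)) → 0 ≤ QuatMoore.mixedDisc A) ∧
    (∀ (m : ℕ) (A : Fin m → QuatMoore.HyperHerm (m + 2)),
      (∀ i, QuatMoore.IsPosDef (A i)) →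
      ∃ B : LinearMap.BilinForm ℝ (QuatMoore.HyperHerm (m + 2)),
        (∀ X Y, B X Y = QuatMoore.mixedDisc (Matrix.vecCons X (Matrix.vecCons Y A))) ∧
        B.IsSymm ∧
        B.Nondegenerate ∧
        sigPos B.toQuadraticMap = 1 ∧
        sigNeg B.toQuadraticMap + 1 = Module.finrank ℝ (QuatMoore.HyperHerm (m + 2))) := by
  refine ⟨fun n A hA => QuatMoore.mixedDisc_pos A hA, fun n A hA => QuatMoore.mixedDisc_nonneg A hA,
    fun m A hA => ?_⟩
  have hL := QuatMoore.mixedForm_isLorentzian hA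
  have hN := QuatMoore.mixedForm_nondegenerate hA
  exact ⟨QuatMoore.mixedForm A, QuatMoore.mixedForm_eq_mixedDisc A, hL.isSymm, hN,
    hL.sigPos_eq_one, hL.sigNeg_add_one_eq_finrank hN⟩
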